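/- Let $d\ge 1$, let $I_\pm=\{\pm1,\dots,\pm d\}$ and let $\{|\tau\rangle\}_{\tau\in I_\pm}$ be the canonical basis of $\mathbb C^{2d}$. Let $r:I_\pm\to\mathbb Z^d$ be an arbitrary jump function, with mean $\overline r=\frac1{2d}\sum_{\tau\in I_\pm} r(\tau)$. On $\mathbb C^{2d}\otimes \ell^2(\mathbb Z^d)$ let $S$ be the shift $S\,|\tau\rangle\otimes|x\rangle=|\tau\rangle\otimes|x+r(\tau)\rangle$. Let $C(\omega)$ be a random unitary $2d\times 2d$ matrix on a probability space $(\Omega,\mu)$ and let $\overline\omega=(\omega_1,\omega_2,\dots)$ be distributed according to $\mathbb P=\mu^{\otimes\mathbb N^*}$. Put $U_{\overline\omega}(n,0)=U_n\cdots U_1$ with $U_s=S\,(C(\omega_s)\otimes\mathbb I)$. For a unit vector $\varphi_0\in\mathbb C^{2d}$ and $\psi_0=\varphi_0\otimes|0\rangle$, let $W^{\overline\omega}_k(n)=\|(U_{\overline\omega}(n,0)\psi_0)(k)\|^2_{\mathbb C^{2d}}$ for $k\in\mathbb Z^d$, let $w_k(n)=\mathbb E\,(W^{\overline\omega}_k(n))$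 be the averaged distribution, and let $X_n$ be a $\mathbb Z^d$-valued random vector with law $w(n)$. Let $\mathcal E=\mathbb E(C(\omega)\otimes\overline{C(\omega)})$ on $\mathbb C^{2d}\otimes\mathbb C^{2d}$, let $D(y,y')$ be the diagonal matrix with $D(y,y')\,|\tau\otimes\tau'\rangle=e^{i(y\cdot r(\tau)+y'\cdot r(\tau'))}|\tau\otimes\tau'\rangle$, and let $\mathcal M(y,y')=D(y,y')\,\mathcal E$ for $y,y'\in\mathbb R^d$. Assumption S: for every $v\in\mathbb T^d=(\mathbb R/2\pi\mathbb Z)^d$, the only point of the spectrum of $\mathcal M(-v,v)$ on the unit circle is $1$, and $1$ is a simple eigenvalue of $\mathcal M(-v,v)$. Let $P=|\Psi_0\rangle\langle\Psi_0|$ with $\Psi_0=\frac1{\sqrt{2d}}\sum_{\tau\in I_\pm}|\tau\otimes\tau\rangle$. Let $S_v(1)$ be the value at $z=1$ of the reduced resolvent $S_v(z)$ of $\mathcal M(-v,v)$, which is defined near $z=1$ by $(\mathcal M(-v,v)-z)^{-1}=\frac{P}{1-z}+S_v(z)$. For $v\in\mathbb T^d$ the diffusion matrix $\mathbb D(v)$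 is the $d\times d$ matrix with entries $$\mathbb D_{ij}(v)=\overline r_i\,\overline r_j-\frac1{2d}\sum_{\tau\in I_\pm} r_i(\tau)r_j(\tau)-\frac1{2d}\sum_{\tau,\tau'\in I_\pm}\bigl(r_i(\tau)r_j(\tau')+r_j(\tau)r_i(\tau')\bigr)\langle\tau\otimes\tau|S_v(1)\,\tau'\otimes\tau'\rangle .$$ Equivalently, $\mathbb D(v)$ is the symmetric matrix for which the eigenvalue $\lambda_1(y,v)$ of $\mathcal M(y-v,v)$ close to $1$ satisfies $e^{-iy\cdot\overline r}\lambda_1(y,v)=1-\frac12\langle y|\mathbb D(v)y\rangle+O(\|y\|^3)$ as $y\to0$. Corollary. Suppose that Assumption S holds and that $\mathbb D(v)=\mathbb D$ does not depend on $v\in\mathbb T^d$, where $\mathbb D$ is a real positive definite matrix. Then, for every initial vector $\psi_0=\varphi_0\otimes|0\rangle$ with $\|\varphi_0\|=1$, as $n\to\infty$, $$\frac{X_n-n\overline r}{\sqrt n}\longrightarrow \mathcal N(0,\mathbb D)\quad\text{in distribution.}$$ -/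

import Mathlib

open MeasureTheory ProbabilityTheory Filter Topology

open scoped Matrix Kronecker ENNReal

noncomputable section

namespace QuantumWalk

/-- The `2d` coin labels `I_± = {±1, …, ±d}`; the pair `(j, ε)` stands for `ε (j + 1)`. -/
abbrev Coin (d : ℕ) : Type := Fin d × ℤˣ

/-- The coin space `ℂ^{2d}`. -/
abbrev CoinSpace (d : ℕ) : Type := EuclideanSpace ℂ (Coin d)

/-- The Hilbert space of the walker, `ℂ^{2d} ⊗ ℓ²(ℤ^d)`, realised as `ℓ²(ℤ^d; ℂ^{2d})`. -/
abbrev WalkSpace (d : ℕ) : Type := lp (fun _ : Fin d → ℤ => CoinSpace d) 2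

variable {d : ℕ}

theorem memlp_coin (C : Matrix (Coin d) (Coin d) ℂ) (ψ : WalkSpace d) :
    Memℓp (fun x : Fin d → ℤ => (WithLp.toLp 2 (C *ᵥ (ψ x).ofLp) : CoinSpace d)) 2 := by
  have hψ := (lp.memℓp ψ).summable (by norm_num)
  refine memℓp_gen ?_
  simp only [ENNReal.toReal_ofNat, Real.rpow_ofNat] at hψ ⊢
  refine Summable.of_nonneg_of_le (fun x => by positivity) (fun x => ?_)
    (hψ.mul_left (‖Matrix.toEuclideanCLM (𝕜 := ℂ) C‖ ^ 2))
  rw [← mul_pow]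
  have h := (Matrix.toEuclideanCLM (𝕜 := ℂ) C).le_opNorm (ψ x)
  gcongr
  exact h

theorem memlp_shift (r : Coin d → Fin d → ℤ) (ψ : WalkSpace d) :
    Memℓp (fun x : Fin d → ℤ => (WithLp.toLp 2 fun τ => ψ (x - r τ) τ : CoinSpace d)) 2 := by
  have hψ := (lp.memℓp ψ).summable (by norm_num)
  refine memℓp_gen ?_
  simp only [ENNReal.toReal_ofNat, Real.rpow_ofNat, EuclideanSpace.norm_sq_eq] at hψ ⊢
  refine summable_sum fun τ _ => ?_
  have h1 : Summable fun x : Fin d → ℤ => ‖ψ x τ‖ ^ 2 :=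
    Summable.of_nonneg_of_le (fun x => by positivity)
      (fun x => Finset.single_le_sum (f := fun σ => ‖ψ x σ‖ ^ 2)
        (fun σ _ => by positivity) (Finset.mem_univ τ)) hψ
  exact h1.comp_injective (Equiv.subRight (r τ)).injective

/-- The coin update `C ⊗ 𝟙`. -/
def coinOp (C : Matrix (Coin d) (Coin d) ℂ) (ψ : WalkSpace d) : WalkSpace d :=
  ⟨fun x => WithLp.toLp 2 (C *ᵥ (ψ x).ofLp), memlp_coin C ψ⟩

/-- The shift `S (|τ⟩ ⊗ |y⟩) = |τ⟩ ⊗ |y + r(τ)⟩`, that is `(S ψ)(x)_τ = ψ(x - r(τ))_τ`. -/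
def shiftOp (r : Coin d → Fin d → ℤ) (ψ : WalkSpace d) : WalkSpace d :=
  ⟨fun x => WithLp.toLp 2 fun τ => ψ (x - r τ) τ, memlp_shift r ψ⟩

/-- The evolution `U_n ⋯ U_1` with `U_s = S (C_s ⊗ 𝟙)`; the `s`-th coin matrix is `c (s - 1)`. -/
def evolution (r : Coin d → Fin d → ℤ) (c : ℕ → Matrix (Coin d) (Coin d) ℂ) :
    ℕ → WalkSpace d → WalkSpace d
  | 0, ψ => ψ
  | n + 1, ψ => shiftOp r (coinOp (c n) (evolution r c n ψ))

/-- `W_k(n)`: the probability to find the walker at `k` at time `n`, when it starts in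
`φ₀ ⊗ |0⟩`. -/
def positionDist (r : Coin d → Fin d → ℤ) (c : ℕ → Matrix (Coin d) (Coin d) ℂ)
    (φ₀ : CoinSpace d) (n : ℕ) (k : Fin d → ℤ) : ℝ :=
  ‖evolution r c n (lp.single 2 0 φ₀) k‖ ^ 2

section Random

variable {Ω : Type*} [MeasurableSpace Ω]

/-- `w_k(n) = 𝔼 (W_k(n))`, for i.i.d. coin matrices `C(ω_1), C(ω_2), …` under `μ^{⊗ ℕ}`. -/
def averagedDist (μ : Measure Ω) [IsProbabilityMeasure μ] (C : Ω → Matrix (Coin d) (Coin d) ℂ)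
    (r : Coin d → Fin d → ℤ) (φ₀ : CoinSpace d) (n : ℕ) (k : Fin d → ℤ) : ℝ :=
  ∫ ω, positionDist r (fun s => C (ω s)) φ₀ n k ∂(Measure.infinitePi fun _ : ℕ => μ)

/-- The averaged distribution `w(n)` as a measure on `ℤ^d`. -/
def averagedLaw (μ : Measure Ω) [IsProbabilityMeasure μ] (C : Ω → Matrix (Coin d) (Coin d) ℂ)
    (r : Coin d → Fin d → ℤ) (φ₀ : CoinSpace d) (n : ℕ) : Measure (Fin d → ℤ) :=
  Measure.sum fun k => ENNReal.ofReal (averagedDist μ C r φ₀ n k) • Measure.dirac k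

/-- The drift `r̄ = (2d)⁻¹ ∑_τ r(τ)`. -/
def drift (r : Coin d → Fin d → ℤ) : EuclideanSpace ℝ (Fin d) :=
  WithLp.toLp 2 fun j => (2 * (d : ℝ))⁻¹ * ∑ τ, (r τ j : ℝ)

/-- The point `(k - n r̄) / √n`. -/
def rescale (r : Coin d → Fin d → ℤ) (n : ℕ) (k : Fin d → ℤ) : EuclideanSpace ℝ (Fin d) :=
  (√(n : ℝ))⁻¹ • (WithLp.toLp 2 (fun j => (k j : ℝ)) - (n : ℝ) • drift r)

/-- `ℰ = 𝔼 (C(ω) ⊗ C̄(ω))`, the expectation being taken entrywise. -/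
def meanTensor (μ : Measure Ω) (C : Ω → Matrix (Coin d) (Coin d) ℂ) :
    Matrix (Coin d × Coin d) (Coin d × Coin d) ℂ :=
  Matrix.of fun s t => ∫ ω, (C ω ⊗ₖ (C ω).map star) s t ∂μ

/-- The diagonal matrix `D(y, y')` with entries `exp (i (y ⬝ r(τ) + y' ⬝ r(τ')))`. -/
def phaseMatrix (r : Coin d → Fin d → ℤ) (y y' : Fin d → ℝ) :
    Matrix (Coin d × Coin d) (Coin d × Coin d) ℂ :=
  Matrix.diagonal fun t => Complex.exp (Complex.I *
    ((∑ j, y j * (r t.1 j : ℝ) + ∑ j, y' j * (r t.2 j : ℝ) : ℝ) : ℂ))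

/-- `ℳ(y, y') = D(y, y') ℰ`. -/
def meanM (μ : Measure Ω) (C : Ω → Matrix (Coin d) (Coin d) ℂ) (r : Coin d → Fin d → ℤ)
    (y y' : Fin d → ℝ) : Matrix (Coin d × Coin d) (Coin d × Coin d) ℂ :=
  phaseMatrix r y y' * meanTensor μ C

/-- For every `v`, `1` is the only eigenvalue of `ℳ(-v, v)` on the unit circle, and it is
(algebraically) simple. Quantifying over `v ∈ ℝ^d` is the same as over the torus, since
`ℳ(-v, v)` is `2π`-periodic in each coordinate of `v`. -/
def AssumptionS (μ : Measure Ω) (C : Ω → Matrix (Coin d) (Coin d) ℂ)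
    (r : Coin d → Fin d → ℤ) : Prop :=
  ∀ v : Fin d → ℝ,
    spectrum ℂ (meanM μ C r (-v) v) ∩ Metric.sphere (0 : ℂ) 1 = {1} ∧
      (meanM μ C r (-v) v).charpoly.rootMultiplicity 1 = 1

/-- `Ψ₁ = ∑_τ |τ ⊗ τ⟩`. -/
def psiOne (d : ℕ) : Coin d × Coin d → ℂ := fun t => if t.1 = t.2 then 1 else 0

/-- `P = |Ψ₀⟩⟨Ψ₀|` with `Ψ₀ = Ψ₁ / ‖Ψ₁‖`, where `‖Ψ₁‖² = 2d`. -/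
def projP (d : ℕ) : Matrix (Coin d × Coin d) (Coin d × Coin d) ℂ :=
  (2 * (d : ℂ))⁻¹ • Matrix.vecMulVec (psiOne d) (star (psiOne d))

/-- The value at `z = 1` of the reduced resolvent `S_v`, defined near `z = 1` by
`(ℳ(-v, v) - z)⁻¹ = P / (1 - z) + S_v(z)`. -/
def reducedResolvent (μ : Measure Ω) (C : Ω → Matrix (Coin d) (Coin d) ℂ)
    (r : Coin d → Fin d → ℤ) (v : Fin d → ℝ) :
    Matrix (Coin d × Coin d) (Coin d × Coin d) ℂ :=
  limUnder (𝓝[≠] (1 : ℂ)) fun z =>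
    (meanM μ C r (-v) v - z • (1 : Matrix (Coin d × Coin d) (Coin d × Coin d) ℂ))⁻¹
      - (1 - z)⁻¹ • projP d

/-- The diffusion matrix `𝔻(v)`. It is the symmetric matrix for which the eigenvalue
`λ₁(y, v)` of `ℳ(y - v, v)` close to `1` satisfies
`exp (-i y ⬝ r̄) λ₁(y, v) = 1 - ⟨y, 𝔻(v) y⟩ / 2 + O(‖y‖³)`. -/
def diffusionMatrix (μ : Measure Ω) (C : Ω → Matrix (Coin d) (Coin d) ℂ)
    (r : Coin d → Fin d → ℤ) (v : Fin d → ℝ) : Matrix (Fin d) (Fin d) ℂ :=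
  Matrix.of fun i j =>
    ((drift r i * drift r j : ℝ) : ℂ)
      - (2 * (d : ℂ))⁻¹ * ∑ τ, (r τ i : ℂ) * (r τ j : ℂ)
      - (2 * (d : ℂ))⁻¹ * ∑ τ, ∑ τ',
          ((r τ i : ℂ) * (r τ' j : ℂ) + (r τ j : ℂ) * (r τ' i : ℂ))
            * reducedResolvent μ C r v (τ, τ) (τ', τ')

end Random

end QuantumWalk

end

/-!
The Fourier transform turns the averaged law `w(n)` into the torus integral of
`⟨Ψ₁, ℳ(θ - v, v) ^ n (φ₀ ⊗ φ̄₀)⟩`. As the coins are unitary, `ℳ(-v, v)` is a contraction which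
fixes `Ψ₁` both as a row and as a column vector, so the simplicity of the eigenvalue `1` makes the
reduced resolvent `S` exist. After centring, the matrix at `θ = y / √n` is
`T = exp (X / √n) ℳ(-v, v)` with `P X P = 0` and `P X² P + 2 P X S X P = ⟨y, 𝔻(v) y⟩ P`. No
eigenvalue needs to be tracked: correcting `P` to second order in `n^{-1/2}` gives an approximate
left eigenvector of `T` whose error `o(1 / n)` accumulates only `n` times, because `T` is a
contraction. Hence `P T ^ n → exp (-⟨y, 𝔻(v) y⟩ / 2) P`, and dominated convergence in `v` followed
by Lévy's continuity theorem gives the limit law. The same contraction bound shows that a real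
`𝔻(v)` is positive semidefinite.
-/

noncomputable section

namespace QuantumWalk

section ReducedResolvent

open scoped Ring

/-- `S` is the reduced resolvent of `M` at the eigenvalue `1` with spectral projection `P`: it
inverts `M - 1` on the range of `1 - P` and vanishes on the range of `P`. -/
structure IsReducedResolvent {A : Type*} [Ring A] (M P S : A) : Prop where
  right_inv : (M - 1) * S = 1 - P
  left_inv : S * (M - 1) = 1 - P
  proj_mul : P * S = 0
  mul_proj : S * P = 0

section Algebra

variable {A : Type*} [Ring A] {M P : A}

lemma commute_inverse_right {a b : A} (h : Commute a b) : Commute a b⁻¹ʳ := by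
  by_cases hb : IsUnit b
  · obtain ⟨u, rfl⟩ := hb
    rw [Ring.inverse_unit]
    exact h.units_inv_right
  · rw [Ring.inverse_non_unit _ hb]
    exact Commute.zero_right a

lemma isReducedResolvent_inverse_mul (hPM : P * M = P) (hMP : M * P = P) (hP : P * P = P)
    (hunit : IsUnit (M - P - 1)) : IsReducedResolvent M P ((M - P - 1)⁻¹ʳ * (1 - P)) := by
  have hcommPM : Commute P M := hPM.trans hMP.symm
  have hcomm : Commute P (M - P - 1)⁻¹ʳ := commute_inverse_right
    ((hcommPM.sub_right (Commute.refl P)).sub_right (Commute.one_right P))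
  have hzero : P * (1 - P) = 0 := by rw [mul_sub, mul_one, hP, sub_self]
  have hzero' : (1 - P) * P = 0 := by rw [sub_mul, one_mul, hP, sub_self]
  have hsplit : M - 1 = (M - P - 1) + P := by abel
  have hPS : P * ((M - P - 1)⁻¹ʳ * (1 - P)) = 0 := by
    rw [← mul_assoc, hcomm.eq, mul_assoc, hzero, mul_zero]
  refine ⟨?_, ?_, hPS, by rw [mul_assoc, hzero', mul_zero]⟩
  · rw [hsplit, add_mul, hPS, add_zero, Ring.mul_inverse_cancel_left _ _ hunit]
  · have hswap : (1 - P) * (M - 1) = (M - P - 1) * (1 - P) := by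
      simp only [sub_mul, mul_sub, one_mul, mul_one, hPM, hMP, hP]
      abel
    rw [mul_assoc, hswap, Ring.inverse_mul_cancel_left _ _ hunit]

/-- On the range of `P` the resolvent is `(1 - z)⁻¹`, and on the range of `1 - P` the operators
`M` and `M - P` agree. -/
lemma inverse_sub_smul_one {K : Type*} [Field K] [Algebra K A] (hPM : P * M = P)
    (hMP : M * P = P) (hP : P * P = P) {z : K} (hz : z ≠ 1)
    (hunit : IsUnit (M - P - z • (1 : A))) :
    (M - z • (1 : A))⁻¹ʳ = (M - P - z • (1 : A))⁻¹ʳ * (1 - P) + (1 - z)⁻¹ • P := by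
  set N : A := M - P - z • (1 : A) with hN
  set Y : A := N⁻¹ʳ * (1 - P) + (1 - z)⁻¹ • P with hY
  have hcommPM : Commute P M := hPM.trans hMP.symm
  have hcommP : Commute P N⁻¹ʳ := commute_inverse_right
    ((hcommPM.sub_right (Commute.refl P)).sub_right ((Commute.one_right P).smul_right z))
  have hcommM : Commute M N⁻¹ʳ := commute_inverse_right
    (((Commute.refl M).sub_right hcommPM.symm).sub_right ((Commute.one_right M).smul_right z))
  have hcomm : Commute (M - z • (1 : A)) Y :=
    (((hcommM.mul_right ((Commute.one_right M).sub_right hcommPM.symm)).add_right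
      (hcommPM.symm.smul_right _)).sub_left ((Commute.one_left Y).smul_left z))
  have hrange : (M - z • (1 : A)) * P = (1 - z) • P := by
    rw [sub_mul, hMP, smul_one_mul, sub_smul, one_smul]
  have hker : P * (N⁻¹ʳ * (1 - P)) = 0 := by
    rw [← mul_assoc, hcommP.eq, mul_assoc, mul_sub, mul_one, hP, sub_self, mul_zero]
  have hright : (M - z • (1 : A)) * Y = 1 := by
    have hsplit : (M - z • (1 : A)) * (N⁻¹ʳ * (1 - P)) = 1 - P := by
      rw [show M - z • (1 : A) = N + P by rw [hN]; abel, add_mul, hker, add_zero,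
        Ring.mul_inverse_cancel_left _ _ hunit]
    rw [hY, mul_add, hsplit, mul_smul_comm, hrange, inv_smul_smul₀ (sub_ne_zero.2 hz.symm),
      sub_add_cancel]
  exact Ring.inverse_unit (⟨_, Y, hright, hcomm.eq ▸ hright⟩ : Aˣ)

end Algebra

variable {A : Type*} [NormedRing A] [NormedAlgebra ℂ A] {M P : A}

lemma tendsto_inverse_sub_smul_proj [CompleteSpace A] (hPM : P * M = P) (hMP : M * P = P)
    (hP : P * P = P) (hunit : IsUnit (M - P - 1)) :
    Tendsto (fun z : ℂ => (M - z • (1 : A))⁻¹ʳ - (1 - z)⁻¹ • P) (𝓝[≠] 1)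
      (𝓝 ((M - P - 1)⁻¹ʳ * (1 - P))) := by
  have hcont : ContinuousAt (fun z : ℂ => M - P - z • (1 : A)) 1 := by fun_prop
  have hlim : Tendsto (fun z : ℂ => M - P - z • (1 : A)) (𝓝 1) (𝓝 (M - P - 1)) := by
    simpa only [one_smul] using hcont.tendsto
  have hinv : Tendsto (fun z : ℂ => (M - P - z • (1 : A))⁻¹ʳ) (𝓝 1) (𝓝 (M - P - 1)⁻¹ʳ) :=
    (NormedRing.inverse_continuousAt hunit.unit).tendsto.comp hlim
  have hunits : ∀ᶠ z : ℂ in 𝓝 1, IsUnit (M - P - z • (1 : A)) :=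
    hlim.eventually (Units.isOpen.mem_nhds hunit)
  refine ((hinv.mono_left nhdsWithin_le_nhds).mul_const (1 - P)).congr' ?_
  filter_upwards [self_mem_nhdsWithin, nhdsWithin_le_nhds hunits] with z hz hz_unit
  rw [inverse_sub_smul_one hPM hMP hP hz hz_unit, add_sub_cancel_right]

end ReducedResolvent

section Perturbation

open Asymptotics

variable {A : Type*} [NormedRing A]

lemma norm_mul_pow_le (X : A) {T : A} (hT : ‖T‖ ≤ 1) (n : ℕ) : ‖X * T ^ n‖ ≤ ‖X‖ := by
  induction n with
  | zero => simp
  | succ n ih =>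
    rw [pow_succ, ← mul_assoc]
    exact (norm_mul_le_of_le ih hT).trans_eq (mul_one _)

lemma norm_mul_pow_sub_pow_smul_le {𝕜 : Type*} [NormedField 𝕜] [NormedAlgebra 𝕜 A] (L : A) {T : A}
    {m : 𝕜} {c : ℝ} (hT : ‖T‖ ≤ 1) (hm : ‖m‖ ≤ c) (hc : 1 ≤ c) (n : ℕ) :
    ‖L * T ^ n - m ^ n • L‖ ≤ n * c ^ n * ‖L * T - m • L‖ := by
  induction n with
  | zero => simp
  | succ n ih =>
    have hsplit : L * T ^ (n + 1) - m ^ (n + 1) • L =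
        (L * T ^ n - m ^ n • L) * T + m ^ n • (L * T - m • L) := by
      rw [pow_succ, pow_succ, sub_mul, smul_mul_assoc, smul_sub, smul_smul, mul_assoc]
      abel
    have hpow : ‖m ^ n • (L * T - m • L)‖ ≤ c ^ n * ‖L * T - m • L‖ := by
      rw [norm_smul, norm_pow]
      gcongr
    calc ‖L * T ^ (n + 1) - m ^ (n + 1) • L‖
        ≤ n * c ^ n * ‖L * T - m • L‖ * 1 + c ^ n * ‖L * T - m • L‖ := by
          rw [hsplit]
          exact norm_add_le_of_le (norm_mul_le_of_le ih hT) hpow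
      _ = (n + 1) * c ^ n * ‖L * T - m • L‖ := by ring
      _ ≤ (n + 1 : ℕ) * c ^ (n + 1) * ‖L * T - m • L‖ := by
          push_cast
          gcongr
          exact n.le_succ

variable [NormedAlgebra ℂ A]

lemma isLittleO_exp_smul_sub [CompleteSpace A] (X : A) :
    (fun ε : ℂ => NormedSpace.exp (ε • X) - (1 + ε • X + (ε ^ 2 / 2) • X ^ 2)) =o[𝓝 0]
      fun ε : ℂ => ε ^ 2 := by
  have htend : Tendsto (fun ε : ℂ => ε • X) (𝓝 0) (𝓝 0) :=
    (continuous_id.smul continuous_const).tendsto' _ _ (zero_smul ℂ X)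
  have hO := ((NormedSpace.exp_hasFPowerSeriesAt_zero (𝕂 := ℂ)
    (𝔸 := A)).isBigO_sub_partialSum_pow 3).comp_tendsto htend
  have hcube : (fun ε : ℂ => ‖ε • X‖ ^ 3) =O[𝓝 0] fun ε : ℂ => ε ^ 3 :=
    IsBigO.of_bound (‖X‖ ^ 3) (Eventually.of_forall fun ε => by
      simp only [norm_smul, norm_pow, norm_mul, norm_norm]
      exact (by ring : _ = _).le)
  refine ((hO.trans hcube).trans_isLittleO (isLittleO_pow_pow (by norm_num))).congr_left ?_
  intro ε
  simp [FormalMultilinearSeries.partialSum, Finset.sum_range_succ, NormedSpace.expSeries_apply_eq,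
    smul_pow, smul_smul, div_eq_inv_mul]

lemma ofReal_inv_sqrt_sq (n : ℕ) : (((√n)⁻¹ : ℝ) : ℂ) ^ 2 = (n : ℂ)⁻¹ := by
  rw [← Complex.ofReal_pow, inv_pow, Real.sq_sqrt n.cast_nonneg, Complex.ofReal_inv,
    Complex.ofReal_natCast]

lemma tendsto_ofReal_inv_sqrt :
    Tendsto (fun n : ℕ => (((√n)⁻¹ : ℝ) : ℂ)) atTop (𝓝 0) := by
  have h := (Real.tendsto_sqrt_atTop.comp tendsto_natCast_atTop_atTop).inv_tendsto_atTop
  exact_mod_cast (Complex.continuous_ofReal.tendsto 0).comp h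

/-- An approximate left eigenvector `L ε` with eigenvalue `1 - ε² q / 2 + o(ε²)` is propagated by
telescoping, since the `n` errors of order `o(1 / n)` are not amplified by a contraction. -/
lemma tendsto_mul_pow_of_approx_eigen {P : A} {L T : ℂ → A} {q : ℂ}
    (hT : ∀ ε : ℝ, ‖T ε‖ ≤ 1) (hL : Tendsto L (𝓝 0) (𝓝 P))
    (hLT : (fun ε => L ε * T ε - (1 - ε ^ 2 * q / 2) • L ε) =o[𝓝 0] fun ε : ℂ => ε ^ 2) :
    Tendsto (fun n : ℕ => P * T ((√n)⁻¹ : ℝ) ^ n) atTop (𝓝 (Complex.exp (-(q / 2)) • P)) := by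
  set ε : ℕ → ℂ := fun n => ((√n)⁻¹ : ℝ)
  set m : ℕ → ℂ := fun n => 1 + -(q / 2) / n with hm
  set c : ℕ → ℝ := fun n => 1 + ‖q / 2‖ / n
  have hε_lim : Tendsto ε atTop (𝓝 0) := tendsto_ofReal_inv_sqrt
  have hε_sq (n : ℕ) : ε n ^ 2 = (n : ℂ)⁻¹ := ofReal_inv_sqrt_sq n
  have hdefect : Tendsto (fun n => n * ‖L (ε n) * T (ε n) - m n • L (ε n)‖) atTop (𝓝 0) := by
    have h := (hLT.norm_left.norm_right.comp_tendsto hε_lim).tendsto_div_nhds_zero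
    refine h.congr fun n => ?_
    have hmn : 1 - (n : ℂ)⁻¹ * q / 2 = m n := by
      simp only [hm]
      ring
    simp only [Function.comp_apply, hε_sq, hmn, norm_inv, RCLike.norm_natCast, div_inv_eq_mul]
    exact mul_comm _ _
  have hclose : Tendsto (fun n => P * T (ε n) ^ n - m n ^ n • L (ε n)) atTop (𝓝 0) := by
    refine squeeze_zero_norm (a := fun n =>
      ‖P - L (ε n)‖ + c n ^ n * (n * ‖L (ε n) * T (ε n) - m n • L (ε n)‖)) (fun n => ?_) ?_
    · have hm_le : ‖m n‖ ≤ c n := norm_add_le_of_le norm_one.le (by simp)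
      have hc_ge : 1 ≤ c n := le_add_of_nonneg_right (by positivity)
      have htel := norm_mul_pow_sub_pow_smul_le (L (ε n)) (hT (√n)⁻¹) hm_le hc_ge n
      have hsplit : P * T (ε n) ^ n - m n ^ n • L (ε n) =
          (P - L (ε n)) * T (ε n) ^ n + (L (ε n) * T (ε n) ^ n - m n ^ n • L (ε n)) := by
        rw [sub_mul, sub_add_sub_cancel]
      rw [hsplit, ← mul_assoc, mul_comm (c n ^ n)]
      exact norm_add_le_of_le (norm_mul_pow_le _ (hT _) n) htel
    · have hdiff := (tendsto_const_nhds.sub (hL.comp hε_lim)).norm (a := P - P)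
      have hzero : ‖P - P‖ + Real.exp ‖q / 2‖ * 0 = 0 := by simp
      exact hzero ▸ hdiff.add ((Real.tendsto_one_add_div_pow_exp ‖q / 2‖).mul hdefect)
  have hmain := (Complex.tendsto_one_add_div_pow_exp (-(q / 2))).smul (hL.comp hε_lim)
  have hsum := hclose.add hmain
  rw [zero_add] at hsum
  exact hsum.congr fun n => sub_add_cancel _ _

/-- The perturbed left eigenvector is sought as `P + ε L₁ + ε² L₂`: comparing the coefficients of
`ε` and `ε²` and inverting `T₀ - 1` by `S` gives `L₁ = -P T₁ S` and `L₂ = -B S`. -/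
lemma exists_isLittleO_mul_sub_smul {P S T₀ T₁ T₂ : A} {T : ℂ → A} {q : ℂ} (hP : P * P = P)
    (hPT : P * T₀ = P) (hS : S * (T₀ - 1) = 1 - P) (h₁ : P * T₁ * P = 0)
    (h₂ : P * (T₂ - T₁ * S * T₁) * P = -(q / 2) • P)
    (hT : (fun ε => T ε - (T₀ + ε • T₁ + ε ^ 2 • T₂)) =o[𝓝 0] fun ε : ℂ => ε ^ 2) :
    ∃ L₁ L₂ : A, (fun ε : ℂ => (P + ε • L₁ + ε ^ 2 • L₂) * T ε -
      (1 - ε ^ 2 * q / 2) • (P + ε • L₁ + ε ^ 2 • L₂)) =o[𝓝 0] fun ε : ℂ => ε ^ 2 := by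
  set B : A := P * T₂ - P * T₁ * S * T₁ + (q / 2) • P with hB
  set L₁ : A := -(P * T₁ * S) with hL₁
  set L₂ : A := -(B * S) with hL₂
  have hBP : B * P = 0 := by
    rw [hB, add_mul, smul_mul_assoc, hP, ← add_eq_zero_iff_eq_neg.2 (h₂.trans (neg_smul _ _))]
    noncomm_ring
  have hfirst : P * T₁ + L₁ * T₀ - L₁ = 0 := by
    calc P * T₁ + L₁ * T₀ - L₁ = P * T₁ - P * T₁ * (S * (T₀ - 1)) := by rw [hL₁]; noncomm_ring
      _ = P * T₁ * P := by rw [hS]; noncomm_ring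
      _ = 0 := h₁
  have hsecond : P * T₂ + L₁ * T₁ + L₂ * T₀ + (q / 2) • P - L₂ = 0 := by
    calc P * T₂ + L₁ * T₁ + L₂ * T₀ + (q / 2) • P - L₂ = B - B * (S * (T₀ - 1)) := by
          rw [hL₂, hL₁, mul_sub S, mul_sub B, hB]
          noncomm_ring
      _ = B * P := by rw [hS]; noncomm_ring
      _ = 0 := hBP
  refine ⟨L₁, L₂, ?_⟩
  have hcubic : (fun ε : ℂ => ε ^ 3 • (L₁ * T₂ + L₂ * T₁ + (q / 2) • L₁ +
      ε • (L₂ * T₂ + (q / 2) • L₂))) =o[𝓝 0] fun ε : ℂ => ε ^ 2 := by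
    have hcont : ContinuousAt (fun ε : ℂ => L₁ * T₂ + L₂ * T₁ + (q / 2) • L₁ +
      ε • (L₂ * T₂ + (q / 2) • L₂)) 0 := by fun_prop
    simpa using (isLittleO_pow_pow (𝕜 := ℂ) (by norm_num : 2 < 3)).smul_isBigO
      (hcont.tendsto.isBigO_one ℂ)
  have hrest : (fun ε : ℂ => (P + ε • L₁ + ε ^ 2 • L₂) *
      (T ε - (T₀ + ε • T₁ + ε ^ 2 • T₂))) =o[𝓝 0] fun ε : ℂ => ε ^ 2 := by
    have hcont : ContinuousAt (fun ε : ℂ => P + ε • L₁ + ε ^ 2 • L₂) 0 := by fun_prop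
    simpa using (hcont.tendsto.isBigO_one ℂ).mul_isLittleO hT
  refine (hcubic.add hrest).congr_left fun ε => ?_
  simp only [mul_sub, mul_add, add_mul, smul_mul_assoc, mul_smul_comm, hPT]
  linear_combination (norm := module) (-ε) • hfirst - ε ^ 2 • hsecond

lemma IsReducedResolvent.proj_mul_secondOrder_mul_proj {M P S X : A} (hS : IsReducedResolvent M P S)
    {q : ℂ} (hMP : M * P = P) (hX : P * X * P = 0)
    (hq : P * X ^ 2 * P + (2 : ℂ) • (P * X * S * X * P) = q • P) :
    P * ((1 / 2 : ℂ) • (X ^ 2 * M) - X * M * S * (X * M)) * P = -(q / 2) • P := by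
  have hMS : M * S = S + 1 - P := by
    rw [add_sub_assoc, ← hS.right_inv]
    noncomm_ring
  have hcross : P * (X * M * S * (X * M)) * P = P * X * S * X * P + P * X ^ 2 * P := by
    calc P * (X * M * S * (X * M)) * P = P * X * (M * S) * X * (M * P) := by noncomm_ring
      _ = P * X * S * X * P + P * X ^ 2 * P - P * X * P * X * P := by
          rw [hMS, hMP]
          noncomm_ring
      _ = P * X * S * X * P + P * X ^ 2 * P := by rw [hX, zero_mul, zero_mul, sub_zero]
  rw [mul_sub, sub_mul, hcross, mul_smul_comm, smul_mul_assoc, ← mul_assoc, mul_assoc _ M, hMP]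
  linear_combination (norm := module) (-(1 / 2) : ℂ) • hq

/-- Second-order perturbation theory for the powers of a family of contractions `exp (ε X) M`. The
matrix counterpart of the central limit theorem: `X` is centred, `q` is its variance. -/
theorem IsReducedResolvent.tendsto_mul_exp_smul_mul_pow [CompleteSpace A] {M P S X : A}
    (hS : IsReducedResolvent M P S) {q : ℂ} (hPM : P * M = P) (hMP : M * P = P) (hP : P * P = P)
    (hT : ∀ ε : ℝ, ‖NormedSpace.exp ((ε : ℂ) • X) * M‖ ≤ 1) (hX : P * X * P = 0)
    (hq : P * X ^ 2 * P + (2 : ℂ) • (P * X * S * X * P) = q • P) :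
    Tendsto (fun n : ℕ => P * (NormedSpace.exp ((((√n)⁻¹ : ℝ) : ℂ) • X) * M) ^ n) atTop
      (𝓝 (Complex.exp (-(q / 2)) • P)) := by
  have hexp : (fun ε : ℂ => NormedSpace.exp (ε • X) * M -
      (M + ε • (X * M) + ε ^ 2 • ((1 / 2 : ℂ) • (X ^ 2 * M)))) =o[𝓝 0] fun ε : ℂ => ε ^ 2 := by
    have h := (isLittleO_exp_smul_sub X).mul_isBigO
      (isBigO_const_const M (one_ne_zero (α := ℂ)) (𝓝 0))
    simp only [mul_one] at h
    refine h.congr_left fun ε => ?_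
    simp only [sub_mul, add_mul, one_mul, smul_mul_assoc]
    module
  obtain ⟨L₁, L₂, hL⟩ := exists_isLittleO_mul_sub_smul hP hPM hS.left_inv
    (by rw [mul_assoc, mul_assoc, hMP, ← mul_assoc, hX])
    (hS.proj_mul_secondOrder_mul_proj hMP hX hq) hexp
  refine tendsto_mul_pow_of_approx_eigen (T := fun ε : ℂ => NormedSpace.exp (ε • X) * M) hT ?_ hL
  have hcont : ContinuousAt (fun ε : ℂ => P + ε • L₁ + ε ^ 2 • L₂) 0 := by fun_prop
  simpa using hcont.tendsto

lemma re_nonneg_of_tendsto_mul_pow {P : A} (hP : P ≠ 0) {T : ℕ → A} (hT : ∀ n, ‖T n‖ ≤ 1) {q : ℂ}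
    (hlim : Tendsto (fun n => P * T n ^ n) atTop (𝓝 (Complex.exp (-(q / 2)) • P))) :
    0 ≤ q.re := by
  have hle : ‖Complex.exp (-(q / 2)) • P‖ ≤ ‖P‖ :=
    le_of_tendsto' hlim.norm fun n => norm_mul_pow_le P (hT n) n
  rw [norm_smul, Complex.norm_exp] at hle
  have hexp := (mul_le_iff_le_one_left (norm_pos_iff.2 hP)).1 hle
  rw [Real.exp_le_one_iff, Complex.neg_re, Complex.div_ofNat_re] at hexp
  linarith

end Perturbation

section EuclideanNorm

variable {ι : Type*} [Fintype ι]

lemma dotProduct_star_self (x : ι → ℂ) : x ⬝ᵥ star x = (‖WithLp.toLp 2 x‖ : ℂ) ^ 2 := by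
  rw [← EuclideanSpace.inner_toLp_toLp, inner_self_eq_norm_sq_to_K]
  rfl

lemma norm_dotProduct_le (x y : ι → ℂ) :
    ‖x ⬝ᵥ y‖ ≤ ‖WithLp.toLp 2 x‖ * ‖WithLp.toLp 2 y‖ := by
  have hstar : ‖WithLp.toLp 2 (star x)‖ = ‖WithLp.toLp 2 x‖ := by
    simp only [EuclideanSpace.norm_eq, Pi.star_apply, norm_star]
  have h := norm_inner_le_norm (𝕜 := ℂ) (WithLp.toLp 2 (star x)) (WithLp.toLp 2 y)
  rwa [EuclideanSpace.inner_toLp_toLp, star_star, dotProduct_comm, hstar] at h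

end EuclideanNorm

section Matrices

variable {ι : Type*} [Fintype ι] [DecidableEq ι]

lemma isUnit_sub_sub_one_of_finrank_eigenspace_le_one {K : Type*} [Field K] {M P : Matrix ι ι K}
    (hPM : P * M = P) (hMP : M * P = P) (hP : P * P = P) (hP0 : P ≠ 0)
    (hsimple : Module.finrank K (Module.End.eigenspace (Matrix.toLin' M) 1) ≤ 1) :
    IsUnit (M - P - 1) := by
  rw [Matrix.isUnit_iff_isUnit_det, isUnit_iff_ne_zero]
  intro hdet
  obtain ⟨x, hx, hx_ker⟩ := Matrix.exists_mulVec_eq_zero_iff.2 hdet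
  obtain ⟨w, hw⟩ : ∃ w, P *ᵥ w ≠ 0 := by
    by_contra! h
    exact hP0 (Matrix.ext_of_mulVec_single fun i => by rw [h, Matrix.zero_mulVec])
  have hPx : P *ᵥ x = 0 := by
    have hPN : P * (M - P - 1) = -P := by rw [mul_sub, mul_sub, hPM, hP, mul_one]; abel
    rw [← neg_eq_zero, ← Matrix.neg_mulVec, ← hPN, ← Matrix.mulVec_mulVec, hx_ker,
      Matrix.mulVec_zero]
  have hMx : M *ᵥ x = x := by
    rwa [Matrix.sub_mulVec, Matrix.sub_mulVec, hPx, sub_zero, Matrix.one_mulVec, sub_eq_zero]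
      at hx_ker
  have hmem {z : ι → K} (hz : M *ᵥ z = z) : z ∈ Module.End.eigenspace (Matrix.toLin' M) 1 := by
    rw [Module.End.mem_eigenspace_iff, Matrix.toLin'_apply, hz, one_smul]
  obtain ⟨⟨u, _⟩, hu⟩ := finrank_le_one_iff.1 hsimple
  obtain ⟨a, ha⟩ := hu ⟨x, hmem hMx⟩
  obtain ⟨b, hb⟩ := hu ⟨P *ᵥ w, hmem (by rw [Matrix.mulVec_mulVec, hMP])⟩
  replace ha : a • u = x := congrArg Subtype.val ha
  replace hb : b • u = P *ᵥ w := congrArg Subtype.val hb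
  have hPu : P *ᵥ u = 0 := by
    have ha0 : a ≠ 0 := fun h => hx (by rw [← ha, h, zero_smul])
    rwa [← ha, Matrix.mulVec_smul, smul_eq_zero_iff_right ha0] at hPx
  apply hw
  rw [← hP, ← Matrix.mulVec_mulVec, ← hb, Matrix.mulVec_smul, hPu, smul_zero]

lemma kronecker_map_star_mem_unitaryGroup {U : Matrix ι ι ℂ} (hU : U ∈ Matrix.unitaryGroup ι ℂ) :
    U ⊗ₖ U.map star ∈ Matrix.unitaryGroup (ι × ι) ℂ :=
  Matrix.kronecker_mem_unitary hU (Matrix.map_star_mem_unitaryGroup_iff.2 hU)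

open scoped Matrix.Norms.L2Operator

lemma norm_dotProduct_mulVec_le (x y : ι → ℂ) (A : Matrix ι ι ℂ) :
    ‖x ⬝ᵥ A *ᵥ y‖ ≤ ‖WithLp.toLp 2 x‖ * (‖A‖ * ‖WithLp.toLp 2 y‖) := by
  refine (norm_dotProduct_le x (A *ᵥ y)).trans ?_
  gcongr
  exact Matrix.l2_opNorm_mulVec A (WithLp.toLp 2 y)

lemma diagonal_mem_unitaryGroup {f : ι → ℂ} (hf : ∀ i, ‖f i‖ = 1) :
    Matrix.diagonal f ∈ Matrix.unitaryGroup ι ℂ := by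
  rw [Matrix.mem_unitaryGroup_iff, Matrix.star_eq_conjTranspose, Matrix.diagonal_conjTranspose,
    Matrix.diagonal_mul_diagonal, Matrix.diagonal_eq_one]
  funext i
  simp [Complex.mul_conj', hf i]

lemma norm_le_one_of_mem_unitaryGroup {U : Matrix ι ι ℂ} (hU : U ∈ Matrix.unitaryGroup ι ℂ) :
    ‖U‖ ≤ 1 := by
  cases isEmpty_or_nonempty ι
  · rw [Subsingleton.elim U 0, norm_zero]
    exact zero_le_one
  · exact (CStarRing.norm_of_mem_unitary hU).le

lemma norm_mulVec_of_mem_unitaryGroup {U : Matrix ι ι ℂ} (hU : U ∈ Matrix.unitaryGroup ι ℂ)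
    (x : ι → ℂ) : ‖WithLp.toLp 2 (U *ᵥ x)‖ = ‖WithLp.toLp 2 x‖ := by
  rw [← sq_eq_sq₀ (norm_nonneg _) (norm_nonneg _), ← Complex.ofReal_inj]
  push_cast
  rw [← dotProduct_star_self, ← dotProduct_star_self, Matrix.star_mulVec, dotProduct_comm,
    ← Matrix.dotProduct_mulVec, Matrix.mulVec_mulVec, ← Matrix.star_eq_conjTranspose,
    Matrix.mem_unitaryGroup_iff'.1 hU, Matrix.one_mulVec, dotProduct_comm]

lemma norm_of_integral_le {α : Type*} [MeasurableSpace α] {ν : Measure α} [IsProbabilityMeasure ν]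
    {A : α → Matrix ι ι ℂ} (hA : ∀ i j, Integrable (fun a => A a i j) ν) {c : ℝ}
    (hc : ∀ a, ‖A a‖ ≤ c) : ‖Matrix.of fun i j => ∫ a, A a i j ∂ν‖ ≤ c := by
  have hsingle (i j : ι) (z : ℂ) : Matrix.single i j z = z • Matrix.single i j (1 : ℂ) := by
    rw [Matrix.smul_single, smul_eq_mul, mul_one]
  have hint (i j : ι) : Integrable (fun a => A a i j • Matrix.single i j (1 : ℂ)) ν :=
    (hA i j).smul_const _
  have heq : (Matrix.of fun i j => ∫ a, A a i j ∂ν) = ∫ a, A a ∂ν := by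
    calc (Matrix.of fun i j => ∫ a, A a i j ∂ν)
        = ∑ i, ∑ j, (∫ a, A a i j ∂ν) • Matrix.single i j (1 : ℂ) := by
          rw [Matrix.matrix_eq_sum_single (Matrix.of _)]
          simp only [Matrix.of_apply, ← hsingle]
      _ = ∫ a, ∑ i, ∑ j, A a i j • Matrix.single i j (1 : ℂ) ∂ν := by
          rw [integral_finsetSum _ fun i _ => integrable_finsetSum _ fun j _ =>
            hint i j]
          simp only [integral_finsetSum _ fun j _ => hint _ j, integral_smul_const]
      _ = ∫ a, A a ∂ν := by
          simp only [← hsingle, ← Matrix.matrix_eq_sum_single]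
  rw [heq]
  simpa using norm_integral_le_of_norm_le_const (ae_of_all ν hc)

lemma exp_smul_I_diagonal (ε : ℝ) (f : ι → ℝ) :
    NormedSpace.exp ((ε : ℂ) • Complex.I • Matrix.diagonal fun i => (f i : ℂ)) =
      Matrix.diagonal fun i => Complex.exp (Complex.I * ((ε * f i : ℝ) : ℂ)) := by
  rw [← Matrix.diagonal_smul, ← Matrix.diagonal_smul, Matrix.exp_diagonal]
  congr 1
  funext i
  rw [Pi.coe_exp, ← Complex.exp_eq_exp_ℂ]
  simp only [Pi.smul_apply, smul_eq_mul, Complex.ofReal_mul]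
  ring_nf

omit [DecidableEq ι] in
lemma ofReal_dotProduct_map_mulVec (x y : ι → ℝ) (A : Matrix ι ι ℝ) :
    (Complex.ofReal ∘ x) ⬝ᵥ A.map Complex.ofReal *ᵥ (Complex.ofReal ∘ y) =
      ((x ⬝ᵥ A *ᵥ y : ℝ) : ℂ) := by
  refine (congrArg _ ?_).trans (RingHom.map_dotProduct Complex.ofRealHom x (A *ᵥ y)).symm
  exact funext fun i => (RingHom.map_mulVec Complex.ofRealHom A y i).symm

end Matrices

section PlaneWave

variable {d : ℕ}

/-- The plane wave `exp (i ξ ⬝ k)`. -/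
def planeWave (ξ : Fin d → ℝ) (k : Fin d → ℤ) : ℂ :=
  Complex.exp (Complex.I * ((∑ j, ξ j * (k j : ℝ) : ℝ) : ℂ))

lemma planeWave_add_right (ξ : Fin d → ℝ) (k l : Fin d → ℤ) :
    planeWave ξ (k + l) = planeWave ξ k * planeWave ξ l := by
  simp only [planeWave, ← Complex.exp_add, ← mul_add, ← Complex.ofReal_add,
    ← Finset.sum_add_distrib, Pi.add_apply, Int.cast_add]

lemma planeWave_add_left (ξ η : Fin d → ℝ) (k : Fin d → ℤ) :
    planeWave (ξ + η) k = planeWave ξ k * planeWave η k := by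
  simp only [planeWave, ← Complex.exp_add, ← mul_add, ← Complex.ofReal_add,
    ← Finset.sum_add_distrib, Pi.add_apply, add_mul]

@[simp]
lemma planeWave_zero_right (ξ : Fin d → ℝ) : planeWave ξ 0 = 1 := by simp [planeWave]

@[simp]
lemma planeWave_zero_left (k : Fin d → ℤ) : planeWave 0 k = 1 := by simp [planeWave]

lemma planeWave_neg_right (ξ : Fin d → ℝ) (k : Fin d → ℤ) :
    planeWave ξ (-k) = planeWave (-ξ) k := by
  simp [planeWave]

lemma star_planeWave (ξ : Fin d → ℝ) (k : Fin d → ℤ) :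
    star (planeWave ξ k) = planeWave (-ξ) k := by
  simp only [planeWave, Complex.star_def, ← Complex.exp_conj, map_mul, Complex.conj_I,
    Complex.conj_ofReal, Pi.neg_apply, neg_mul, Finset.sum_neg_distrib, Complex.ofReal_neg, mul_neg]

lemma norm_planeWave (ξ : Fin d → ℝ) (k : Fin d → ℤ) : ‖planeWave ξ k‖ = 1 := by
  rw [planeWave, mul_comm, Complex.norm_exp_ofReal_mul_I]

lemma continuous_planeWave (k : Fin d → ℤ) : Continuous fun ξ : Fin d → ℝ => planeWave ξ k := by
  unfold planeWave
  fun_prop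

lemma planeWave_eq_prod (ξ : Fin d → ℝ) (k : Fin d → ℤ) :
    planeWave ξ k = ∏ j, Complex.exp (Complex.I * k j * ξ j) := by
  rw [planeWave, ← Complex.exp_sum]
  push_cast
  rw [Finset.mul_sum]
  exact congrArg _ (Finset.sum_congr rfl fun j _ => by ring)

/-- The uniform distribution on the fundamental domain `(0, 2π]^d` of the torus. -/
def torusMeasure (d : ℕ) : Measure (Fin d → ℝ) :=
  Measure.pi fun _ => ProbabilityTheory.cond volume (Set.Ioc 0 (2 * Real.pi))

instance isProbabilityMeasure_cond_Ioc_two_pi :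
    IsProbabilityMeasure (ProbabilityTheory.cond (volume : Measure ℝ) (Set.Ioc 0 (2 * Real.pi))) :=
  cond_isProbabilityMeasure_of_finite (by simp [Real.pi_pos]) (by simp [ENNReal.mul_eq_top])

instance isProbabilityMeasure_torusMeasure : IsProbabilityMeasure (torusMeasure d) := by
  unfold torusMeasure
  infer_instance

lemma integral_cond_Ioc_two_pi_exp (m : ℤ) :
    ∫ x : ℝ, Complex.exp (Complex.I * m * x)
      ∂(ProbabilityTheory.cond volume (Set.Ioc 0 (2 * Real.pi))) = if m = 0 then 1 else 0 := by
  split_ifs with hm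
  · simp only [hm, Int.cast_zero, mul_zero, zero_mul, Complex.exp_zero, integral_const,
      probReal_univ, one_smul]
  · have hperiod : Complex.exp (Complex.I * m * (2 * Real.pi : ℝ)) = 1 :=
      Complex.exp_eq_one_iff.2 ⟨m, by push_cast; ring⟩
    rw [ProbabilityTheory.cond, integral_smul_measure,
      ← intervalIntegral.integral_of_le Real.two_pi_pos.le, integral_exp_mul_complex (by simp [hm]),
      hperiod, Complex.ofReal_zero, mul_zero, Complex.exp_zero, sub_self, zero_div, smul_zero]

lemma integral_planeWave (k : Fin d → ℤ) :
    ∫ v, planeWave v k ∂(torusMeasure d) = if k = 0 then 1 else 0 := by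
  simp only [planeWave_eq_prod, torusMeasure]
  rw [integral_fintype_prod_eq_prod (fun j (x : ℝ) => Complex.exp (Complex.I * k j * x))]
  simp only [integral_cond_Ioc_two_pi_exp]
  split_ifs with hk
  · simp [hk]
  · obtain ⟨j, hj⟩ := Function.ne_iff.1 hk
    exact Finset.prod_eq_zero (Finset.mem_univ j) (if_neg hj)

lemma integrable_planeWave (k : Fin d → ℤ) :
    Integrable (fun v => planeWave v k) (torusMeasure d) :=
  .of_bound (continuous_planeWave k).aestronglyMeasurable 1
    (ae_of_all _ fun v => (norm_planeWave v k).le)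

lemma integral_sum_planeWave_dotProduct_star {ι : Type*} [Fintype ι] (s : Finset (Fin d → ℤ))
    (a b : (Fin d → ℤ) → ι → ℂ) (θ : Fin d → ℝ) :
    ∫ v, (∑ k ∈ s, planeWave (θ - v) k • a k) ⬝ᵥ star (∑ k ∈ s, planeWave (-v) k • b k)
      ∂(torusMeasure d) = ∑ k ∈ s, planeWave θ k * (a k ⬝ᵥ star (b k)) := by
  have hexpand (v : Fin d → ℝ) :
      (∑ k ∈ s, planeWave (θ - v) k • a k) ⬝ᵥ star (∑ k ∈ s, planeWave (-v) k • b k) =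
        ∑ k ∈ s, ∑ l ∈ s, planeWave θ k * (a k ⬝ᵥ star (b l)) * planeWave v (l - k) := by
    rw [sum_dotProduct]
    refine Finset.sum_congr rfl fun k _ => ?_
    rw [star_sum, dotProduct_sum]
    refine Finset.sum_congr rfl fun l _ => ?_
    simp only [star_smul, star_planeWave, neg_neg, smul_dotProduct, dotProduct_smul, smul_eq_mul,
      sub_eq_add_neg, planeWave_add_left, planeWave_add_right, planeWave_neg_right]
    ring
  have hint (k l : Fin d → ℤ) : Integrable
      (fun v => planeWave θ k * (a k ⬝ᵥ star (b l)) * planeWave v (l - k)) (torusMeasure d) :=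
    (integrable_planeWave _).const_mul _
  simp only [hexpand]
  rw [integral_finsetSum _ fun k _ => integrable_finsetSum _ fun l _ => hint k l]
  refine Finset.sum_congr rfl fun k hk => ?_
  rw [integral_finsetSum _ fun l _ => hint k l]
  simp only [integral_const_mul, integral_planeWave, sub_eq_zero, mul_ite, mul_one, mul_zero]
  rw [Finset.sum_ite_eq' _ k, if_pos hk]

end PlaneWave

section Fourier

/-- The state `f ⊗ ḡ` of the doubled coin space. -/
def tensorStar {ι : Type*} (f g : ι → ℂ) : ι × ι → ℂ := fun t => f t.1 * star (g t.2)

lemma kronecker_map_star_mulVec_tensorStar {ι : Type*} [Fintype ι] (A B : Matrix ι ι ℂ)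
    (f g : ι → ℂ) : (A ⊗ₖ B.map star) *ᵥ tensorStar f g = tensorStar (A *ᵥ f) (B *ᵥ g) := by
  funext t
  simp only [tensorStar, Matrix.mulVec, dotProduct, Fintype.sum_prod_type, star_sum,
    Finset.sum_mul_sum, Matrix.kroneckerMap_apply, Matrix.map_apply, star_mul']
  exact Finset.sum_congr rfl fun i _ => Finset.sum_congr rfl fun j _ => by ring

lemma norm_tensorStar {ι : Type*} [Fintype ι] (f g : ι → ℂ) :
    ‖WithLp.toLp 2 (tensorStar f g)‖ = ‖WithLp.toLp 2 f‖ * ‖WithLp.toLp 2 g‖ := by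
  simp only [EuclideanSpace.norm_eq, tensorStar, Fintype.sum_prod_type, norm_mul, norm_star,
    mul_pow]
  rw [← Real.sqrt_mul (Finset.sum_nonneg fun _ _ => sq_nonneg _), Finset.sum_mul_sum]

variable {d : ℕ}

lemma psiOne_dotProduct (x : Coin d × Coin d → ℂ) : psiOne d ⬝ᵥ x = ∑ τ, x (τ, τ) := by
  simp [psiOne, dotProduct, Fintype.sum_prod_type]

lemma psiOne_dotProduct_tensorStar (f g : Coin d → ℂ) :
    psiOne d ⬝ᵥ tensorStar f g = f ⬝ᵥ star g :=
  psiOne_dotProduct _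

/-- A finite set of sites that contains the support of the walker at time `n`. -/
def reach (r : Coin d → Fin d → ℤ) : ℕ → Finset (Fin d → ℤ)
  | 0 => {0}
  | n + 1 => (reach r n ×ˢ Finset.univ).image fun p => p.1 + r p.2

/-- The coin state of the walker at the site `k` at time `n`. -/
def amplitude (r : Coin d → Fin d → ℤ) (c : ℕ → Matrix (Coin d) (Coin d) ℂ) (φ₀ : CoinSpace d)
    (n : ℕ) (k : Fin d → ℤ) : Coin d → ℂ :=
  (evolution r c n (lp.single 2 0 φ₀) k).ofLp

/-- The Fourier transform of the walker at time `n`. -/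
def fourierAmplitude (r : Coin d → Fin d → ℤ) (c : ℕ → Matrix (Coin d) (Coin d) ℂ)
    (φ₀ : CoinSpace d) (n : ℕ) (ξ : Fin d → ℝ) : Coin d → ℂ :=
  ∑ k ∈ reach r n, planeWave ξ k • amplitude r c φ₀ n k

/-- The Fourier transform of the density matrix of the walker at time `n`. The sign of `y'` makes
one step of the walk act by the matrix `D(y, y') (C ⊗ C̄)`. -/
def fourierTensor (r : Coin d → Fin d → ℤ) (c : ℕ → Matrix (Coin d) (Coin d) ℂ)
    (φ₀ : CoinSpace d) (n : ℕ) (y y' : Fin d → ℝ) : Coin d × Coin d → ℂ :=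
  tensorStar (fourierAmplitude r c φ₀ n y) (fourierAmplitude r c φ₀ n (-y'))

variable (r : Coin d → Fin d → ℤ) (c : ℕ → Matrix (Coin d) (Coin d) ℂ) (φ₀ : CoinSpace d)

lemma amplitude_zero_zero : amplitude r c φ₀ 0 0 = φ₀.ofLp := by
  simp [amplitude, evolution]

lemma amplitude_zero_of_ne {k : Fin d → ℤ} (hk : k ≠ 0) : amplitude r c φ₀ 0 k = 0 := by
  simp [amplitude, evolution, Pi.single_eq_of_ne hk]

lemma amplitude_succ (n : ℕ) (k : Fin d → ℤ) :
    amplitude r c φ₀ (n + 1) k = fun τ => (c n *ᵥ amplitude r c φ₀ n (k - r τ)) τ := rfl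

lemma positionDist_nonneg (n : ℕ) (k : Fin d → ℤ) : 0 ≤ positionDist r c φ₀ n k :=
  sq_nonneg _

lemma positionDist_eq_sum (n : ℕ) (k : Fin d → ℤ) :
    positionDist r c φ₀ n k = ∑ τ, ‖amplitude r c φ₀ n k τ‖ ^ 2 :=
  EuclideanSpace.norm_sq_eq _

lemma positionDist_eq_dotProduct_star (n : ℕ) (k : Fin d → ℤ) :
    (positionDist r c φ₀ n k : ℂ) = amplitude r c φ₀ n k ⬝ᵥ star (amplitude r c φ₀ n k) := by
  rw [positionDist, dotProduct_star_self, Complex.ofReal_pow]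
  rfl

lemma add_mem_reach {n : ℕ} {k : Fin d → ℤ} (hk : k ∈ reach r n) (τ : Coin d) :
    k + r τ ∈ reach r (n + 1) :=
  Finset.mem_image.2 ⟨(k, τ), by simp [hk], rfl⟩

lemma amplitude_eq_zero {n : ℕ} {k : Fin d → ℤ} (hk : k ∉ reach r n) :
    amplitude r c φ₀ n k = 0 := by
  induction n generalizing k with
  | zero => exact amplitude_zero_of_ne r c φ₀ (by simpa [reach] using hk)
  | succ n ih =>
    rw [amplitude_succ]
    funext τ
    rw [ih fun h => hk (by simpa using add_mem_reach r h τ), Matrix.mulVec_zero]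

lemma fourierAmplitude_zero (ξ : Fin d → ℝ) : fourierAmplitude r c φ₀ 0 ξ = φ₀.ofLp := by
  simp [fourierAmplitude, reach, amplitude_zero_zero]

lemma fourierAmplitude_succ (n : ℕ) (ξ : Fin d → ℝ) :
    fourierAmplitude r c φ₀ (n + 1) ξ =
      Matrix.diagonal (fun τ => planeWave ξ (r τ)) *ᵥ (c n *ᵥ fourierAmplitude r c φ₀ n ξ) := by
  funext τ
  have hshift : ∑ k ∈ reach r (n + 1), planeWave ξ k * amplitude r c φ₀ (n + 1) k τ =
      ∑ k ∈ reach r n, planeWave ξ (k + r τ) * amplitude r c φ₀ (n + 1) (k + r τ) τ := by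
    rw [← Finset.sum_image (f := fun k => planeWave ξ k * amplitude r c φ₀ (n + 1) k τ)
      (g := fun k => k + r τ) (add_left_injective _).injOn]
    refine (Finset.sum_subset (fun k hk => ?_) fun k _ hk => ?_).symm
    · obtain ⟨l, hl, rfl⟩ := Finset.mem_image.1 hk
      exact add_mem_reach r hl τ
    · have hk' : k - r τ ∉ reach r n := fun h => hk (Finset.mem_image.2 ⟨k - r τ, h, by simp⟩)
      simp only [amplitude_succ, amplitude_eq_zero r c φ₀ hk', Matrix.mulVec_zero, Pi.zero_apply,
        mul_zero]
  simp only [fourierAmplitude, Matrix.mulVec_diagonal, Matrix.mulVec_sum, Matrix.mulVec_smul,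
    Finset.sum_apply, Pi.smul_apply, smul_eq_mul]
  rw [hshift, Finset.mul_sum]
  refine Finset.sum_congr rfl fun k _ => ?_
  simp only [amplitude_succ, add_sub_cancel_right, planeWave_add_right]
  ring

lemma diagonal_planeWave_mem_unitaryGroup (ξ : Fin d → ℝ) :
    Matrix.diagonal (fun τ => planeWave ξ (r τ)) ∈ Matrix.unitaryGroup (Coin d) ℂ :=
  diagonal_mem_unitaryGroup fun τ => norm_planeWave ξ (r τ)

lemma phaseMatrix_eq (y y' : Fin d → ℝ) :
    phaseMatrix r y y' = Matrix.diagonal (fun τ => planeWave y (r τ)) ⊗ₖ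
      (Matrix.diagonal fun τ => planeWave (-y') (r τ)).map star := by
  rw [Matrix.diagonal_map (star_zero ℂ), Matrix.diagonal_kronecker_diagonal]
  simp only [phaseMatrix, star_planeWave, neg_neg]
  simp only [planeWave, ← Complex.exp_add, ← mul_add, ← Complex.ofReal_add]

lemma fourierTensor_zero (y y' : Fin d → ℝ) :
    fourierTensor r c φ₀ 0 y y' = tensorStar φ₀.ofLp φ₀.ofLp := by
  rw [fourierTensor, fourierAmplitude_zero, fourierAmplitude_zero]

lemma fourierTensor_succ (n : ℕ) (y y' : Fin d → ℝ) :
    fourierTensor r c φ₀ (n + 1) y y' =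
      phaseMatrix r y y' *ᵥ ((c n ⊗ₖ (c n).map star) *ᵥ fourierTensor r c φ₀ n y y') := by
  simp only [fourierTensor, kronecker_map_star_mulVec_tensorStar, phaseMatrix_eq,
    fourierAmplitude_succ]

lemma sum_planeWave_mul_positionDist (n : ℕ) (θ : Fin d → ℝ) :
    ∑ k ∈ reach r n, planeWave θ k * positionDist r c φ₀ n k =
      ∫ v, psiOne d ⬝ᵥ fourierTensor r c φ₀ n (θ - v) v ∂(torusMeasure d) := by
  simp only [positionDist_eq_dotProduct_star, ← integral_sum_planeWave_dotProduct_star,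
    fourierTensor, fourierAmplitude, psiOne_dotProduct_tensorStar]

variable {c} (hc : ∀ n, c n ∈ Matrix.unitaryGroup (Coin d) ℂ)

include hc

lemma norm_fourierAmplitude (n : ℕ) (ξ : Fin d → ℝ) :
    ‖WithLp.toLp 2 (fourierAmplitude r c φ₀ n ξ)‖ = ‖φ₀‖ := by
  induction n with
  | zero => rw [fourierAmplitude_zero]
  | succ n ih =>
    rw [fourierAmplitude_succ,
      norm_mulVec_of_mem_unitaryGroup (diagonal_planeWave_mem_unitaryGroup r ξ),
      norm_mulVec_of_mem_unitaryGroup (hc n), ih]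

lemma norm_fourierTensor (n : ℕ) (y y' : Fin d → ℝ) :
    ‖WithLp.toLp 2 (fourierTensor r c φ₀ n y y')‖ = ‖φ₀‖ ^ 2 := by
  rw [fourierTensor, norm_tensorStar, norm_fourierAmplitude r φ₀ hc,
    norm_fourierAmplitude r φ₀ hc, sq]

lemma sum_positionDist (n : ℕ) : ∑ k ∈ reach r n, positionDist r c φ₀ n k = ‖φ₀‖ ^ 2 := by
  have hnorm (v : Fin d → ℝ) : psiOne d ⬝ᵥ fourierTensor r c φ₀ n (0 - v) v = (‖φ₀‖ ^ 2 : ℝ) := by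
    rw [zero_sub, fourierTensor, psiOne_dotProduct_tensorStar,
      dotProduct_star_self, norm_fourierAmplitude r φ₀ hc, Complex.ofReal_pow]
  have h := sum_planeWave_mul_positionDist r c φ₀ n 0
  simp only [planeWave_zero_left, one_mul, hnorm, integral_const, probReal_univ, one_smul] at h
  exact_mod_cast h

end Fourier

section Expectation

variable {d : ℕ}

section Measurability

variable {Θ : Type*} [MeasurableSpace Θ] {c : Θ → ℕ → Matrix (Coin d) (Coin d) ℂ}
  (r : Coin d → Fin d → ℤ) (φ₀ : CoinSpace d) {n : ℕ}
  (hc : ∀ s < n, ∀ σ τ, Measurable fun θ => c θ s σ τ)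

include hc

lemma measurable_amplitude (k : Fin d → ℤ) (τ : Coin d) :
    Measurable fun θ => amplitude r (c θ) φ₀ n k τ := by
  induction n generalizing k τ with
  | zero =>
    by_cases hk : k = 0
    · simp only [hk, amplitude_zero_zero, measurable_const]
    · simp only [amplitude_zero_of_ne r _ φ₀ hk, measurable_const]
  | succ n ih =>
    simp only [amplitude_succ, Matrix.mulVec, dotProduct]
    exact Finset.measurable_fun_sum _ fun σ _ => (hc n n.lt_succ_self τ σ).mul
      (ih (fun s hs => hc s (hs.trans n.lt_succ_self)) _ σ)

lemma measurable_fourierAmplitude {ξ : Θ → Fin d → ℝ} (hξ : Measurable ξ) (τ : Coin d) :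
    Measurable fun θ => fourierAmplitude r (c θ) φ₀ n (ξ θ) τ := by
  simp only [fourierAmplitude, Finset.sum_apply, Pi.smul_apply, smul_eq_mul]
  exact Finset.measurable_fun_sum _ fun k _ =>
    ((continuous_planeWave k).measurable.comp hξ).mul (measurable_amplitude r φ₀ hc k τ)

lemma measurable_fourierTensor {y y' : Θ → Fin d → ℝ} (hy : Measurable y) (hy' : Measurable y')
    (t : Coin d × Coin d) : Measurable fun θ => fourierTensor r (c θ) φ₀ n (y θ) (y' θ) t :=
  (measurable_fourierAmplitude r φ₀ hc hy t.1).mul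
    (continuous_star.measurable.comp (measurable_fourierAmplitude r φ₀ hc hy'.neg t.2))

end Measurability

section Independence

variable {Ω : Type*} [MeasurableSpace Ω]

/-- The `σ`-algebra generated by the first `n` coordinates. -/
abbrev past (Ω : Type*) [MeasurableSpace Ω] (n : ℕ) : MeasurableSpace (ℕ → Ω) :=
  ⨆ i ∈ Set.Iio n, MeasurableSpace.comap (fun ω : ℕ → Ω => ω i) inferInstance

lemma measurable_past_eval {m n : ℕ} (h : m < n) :
    Measurable[past Ω n] fun ω : ℕ → Ω => ω m :=
  (comap_measurable _).mono
    (le_iSup₂_of_le (f := fun i (_ : i ∈ Set.Iio n) =>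
      MeasurableSpace.comap (fun ω : ℕ → Ω => ω i) inferInstance) m h le_rfl) le_rfl

lemma indepFun_past_eval (μ : ℕ → Measure Ω) [∀ i, IsProbabilityMeasure (μ i)] {β γ : Type*}
    [MeasurableSpace β] [MeasurableSpace γ] {n : ℕ} {f : (ℕ → Ω) → β} {g : Ω → γ}
    (hf : Measurable[past Ω n] f) (hg : Measurable g) :
    IndepFun f (fun ω => g (ω n)) (Measure.infinitePi μ) := by
  have hcoord : iIndepFun (fun (i : ℕ) (ω : ℕ → Ω) => ω i) (Measure.infinitePi μ) :=
    iIndepFun_infinitePi (X := fun _ ω => ω) fun _ => measurable_id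
  have hpast := indep_iSup_of_disjoint (fun i => (measurable_pi_apply i).comap_le) hcoord
    (S := Set.Iio n) (T := {n}) (by simp)
  simp only [Set.mem_singleton_iff, iSup_iSup_eq_left] at hpast
  exact indep_of_indep_of_le_left (indep_of_indep_of_le_right hpast
    (hg.comp (comap_measurable fun ω : ℕ → Ω => ω n)).comap_le) hf.comap_le

lemma integral_mulVec {ι κ : Type*} [Fintype κ] {P : Measure Ω} (A : Matrix ι κ ℂ)
    {x : Ω → κ → ℂ} (hx : ∀ j, Integrable (fun ω => x ω j) P) (i : ι) :
    ∫ ω, (A *ᵥ x ω) i ∂P = (A *ᵥ fun j => ∫ ω, x ω j ∂P) i := by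
  simp only [Matrix.mulVec, dotProduct]
  rw [integral_finsetSum _ fun j _ => (hx j).const_mul _]
  simp only [integral_const_mul]

lemma integrable_indepFun_mulVec {ι κ : Type*} [Fintype κ] {P : Measure Ω} {A : Ω → Matrix ι κ ℂ}
    {x : Ω → κ → ℂ} (hA : ∀ i j, Integrable (fun ω => A ω i j) P)
    (hx : ∀ j, Integrable (fun ω => x ω j) P)
    (hAx : ∀ i j, IndepFun (fun ω => A ω i j) (fun ω => x ω j) P) (i : ι) :
    Integrable (fun ω => (A ω *ᵥ x ω) i) P :=
  integrable_finsetSum _ fun j _ => (hAx i j).integrable_mul (hA i j) (hx j)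

lemma integral_indepFun_mulVec {ι κ : Type*} [Fintype κ] {P : Measure Ω} {A : Ω → Matrix ι κ ℂ}
    {x : Ω → κ → ℂ} (hA : ∀ i j, Integrable (fun ω => A ω i j) P)
    (hx : ∀ j, Integrable (fun ω => x ω j) P)
    (hAx : ∀ i j, IndepFun (fun ω => A ω i j) (fun ω => x ω j) P) (i : ι) :
    ∫ ω, (A ω *ᵥ x ω) i ∂P =
      ((Matrix.of fun i j => ∫ ω, A ω i j ∂P) *ᵥ fun j => ∫ ω, x ω j ∂P) i := by
  have hint (j : κ) : Integrable (fun ω => A ω i j * x ω j) P :=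
    (hAx i j).integrable_mul (hA i j) (hx j)
  simp only [Matrix.mulVec, dotProduct, Matrix.of_apply]
  rw [integral_finsetSum _ fun j _ => hint j]
  exact Finset.sum_congr rfl fun j _ => (hAx i j).integral_fun_mul_eq_mul_integral
    (hA i j).aestronglyMeasurable (hx j).aestronglyMeasurable

end Independence

variable {Ω : Type*} [MeasurableSpace Ω] (μ : Measure Ω) [IsProbabilityMeasure μ]
  {C : Ω → Matrix (Coin d) (Coin d) ℂ} (hCmeas : ∀ σ τ, Measurable fun ω => C ω σ τ)
  (hCunit : ∀ ω, C ω ∈ Matrix.unitaryGroup (Coin d) ℂ) (r : Coin d → Fin d → ℤ) (φ₀ : CoinSpace d)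

include hCmeas in
lemma measurable_kronecker_map_star (t s : Coin d × Coin d) :
    Measurable fun ω => (C ω ⊗ₖ (C ω).map star) t s :=
  (hCmeas t.1 s.1).mul (continuous_star.measurable.comp (hCmeas t.2 s.2))

include hCmeas in
lemma measurable_past_fourierTensor (n : ℕ) (y y' : Fin d → ℝ) (t : Coin d × Coin d) :
    Measurable[past Ω n] fun ω : ℕ → Ω => fourierTensor r (fun s => C (ω s)) φ₀ n y y' t :=
  @measurable_fourierTensor _ _ (past Ω n) _ r φ₀ _
    (fun _ hs σ τ => (hCmeas σ τ).comp (measurable_past_eval hs)) _ _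
    (@measurable_const _ _ _ (past Ω n) _) (@measurable_const _ _ _ (past Ω n) _) t

include hCmeas hCunit

lemma integrable_kronecker_map_star (t s : Coin d × Coin d) :
    Integrable (fun ω => (C ω ⊗ₖ (C ω).map star) t s) μ :=
  .of_bound (measurable_kronecker_map_star hCmeas t s).aestronglyMeasurable 1
    (ae_of_all _ fun ω =>
      entry_norm_bound_of_unitary (kronecker_map_star_mem_unitaryGroup (hCunit ω)) t s)

lemma integrable_fourierTensor (n : ℕ) (y y' : Fin d → ℝ) (t : Coin d × Coin d) :
    Integrable (fun ω : ℕ → Ω => fourierTensor r (fun s => C (ω s)) φ₀ n y y' t)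
      (Measure.infinitePi fun _ : ℕ => μ) := by
  refine .of_bound (measurable_fourierTensor r φ₀
    (fun s _ σ τ => (hCmeas σ τ).comp (measurable_pi_apply s)) measurable_const measurable_const
      t).aestronglyMeasurable (‖φ₀‖ ^ 2) (ae_of_all _ fun ω => ?_)
  rw [← norm_fourierTensor r φ₀ (fun s => hCunit (ω s)) n y y']
  exact PiLp.norm_apply_le (p := 2) (β := fun _ => ℂ) (WithLp.toLp 2 _) t

lemma integral_fourierTensor_succ (n : ℕ) (y y' : Fin d → ℝ) (t : Coin d × Coin d) :
    ∫ ω : ℕ → Ω, fourierTensor r (fun s => C (ω s)) φ₀ (n + 1) y y' t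
      ∂(Measure.infinitePi fun _ : ℕ => μ) =
    (meanM μ C r y y' *ᵥ fun s => ∫ ω : ℕ → Ω, fourierTensor r (fun s => C (ω s)) φ₀ n y y' s
      ∂(Measure.infinitePi fun _ : ℕ => μ)) t := by
  have heval := measurePreserving_eval_infinitePi (fun _ : ℕ => μ) n
  have hmean : meanTensor μ C = Matrix.of fun t s => ∫ ω : ℕ → Ω,
      (C (ω n) ⊗ₖ (C (ω n)).map star) t s ∂(Measure.infinitePi fun _ : ℕ => μ) := by
    ext t s
    simp only [meanTensor, Matrix.of_apply]
    conv_lhs => rw [← heval.map_eq]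
    exact integral_map heval.aemeasurable
      (measurable_kronecker_map_star hCmeas t s).aestronglyMeasurable
  have hint (t s : Coin d × Coin d) : Integrable
      (fun ω : ℕ → Ω => (C (ω n) ⊗ₖ (C (ω n)).map star) t s)
      (Measure.infinitePi fun _ : ℕ => μ) := heval.integrable_comp_of_integrable
    (integrable_kronecker_map_star μ hCmeas hCunit t s)
  have hindep (t s : Coin d × Coin d) := (indepFun_past_eval (fun _ : ℕ => μ)
    (measurable_past_fourierTensor hCmeas r φ₀ n y y' s)
    (measurable_kronecker_map_star hCmeas t s)).symm
  have hF := integrable_fourierTensor μ hCmeas hCunit r φ₀ n y y'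
  have hstep := funext (integral_indepFun_mulVec hint hF hindep)
  simp only [fourierTensor_succ]
  rw [integral_mulVec _ (integrable_indepFun_mulVec hint hF hindep), meanM,
    ← Matrix.mulVec_mulVec, hmean]
  exact congrArg (fun x => (phaseMatrix r y y' *ᵥ x) t) hstep

lemma integral_fourierTensor (n : ℕ) (y y' : Fin d → ℝ) (t : Coin d × Coin d) :
    ∫ ω : ℕ → Ω, fourierTensor r (fun s => C (ω s)) φ₀ n y y' t
      ∂(Measure.infinitePi fun _ : ℕ => μ) =
    (meanM μ C r y y' ^ n *ᵥ tensorStar φ₀.ofLp φ₀.ofLp) t := by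
  induction n generalizing t with
  | zero => simp [fourierTensor_zero]
  | succ n ih =>
    rw [integral_fourierTensor_succ μ hCmeas hCunit, pow_succ', ← Matrix.mulVec_mulVec]
    simp only [ih]

open scoped Matrix.Norms.L2Operator in
lemma norm_meanTensor_le_one : ‖meanTensor μ C‖ ≤ 1 :=
  norm_of_integral_le (integrable_kronecker_map_star μ hCmeas hCunit)
    fun ω => norm_le_one_of_mem_unitaryGroup (kronecker_map_star_mem_unitaryGroup (hCunit ω))

lemma integrable_positionDist (n : ℕ) {k : Fin d → ℤ} (hk : k ∈ reach r n) :
    Integrable (fun ω : ℕ → Ω => positionDist r (fun s => C (ω s)) φ₀ n k)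
      (Measure.infinitePi fun _ : ℕ => μ) := by
  have hmeas : Measurable fun ω : ℕ → Ω => positionDist r (fun s => C (ω s)) φ₀ n k := by
    simp only [positionDist_eq_sum]
    exact Finset.measurable_fun_sum _ fun τ _ => (measurable_amplitude r φ₀
      (fun s _ σ τ => (hCmeas σ τ).comp (measurable_pi_apply s)) k τ).norm.pow_const 2
  refine .of_bound hmeas.aestronglyMeasurable (‖φ₀‖ ^ 2) (ae_of_all _ fun ω => ?_)
  rw [Real.norm_of_nonneg (positionDist_nonneg ..),
    ← sum_positionDist r φ₀ (fun s => hCunit (ω s)) n]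
  exact Finset.single_le_sum (f := fun k => positionDist r (fun s => C (ω s)) φ₀ n k)
    (fun _ _ => positionDist_nonneg ..) hk

lemma sum_planeWave_mul_averagedDist (n : ℕ) (θ : Fin d → ℝ) :
    ∑ k ∈ reach r n, planeWave θ k * averagedDist μ C r φ₀ n k =
      ∫ v, psiOne d ⬝ᵥ (meanM μ C r (θ - v) v ^ n *ᵥ tensorStar φ₀.ofLp φ₀.ofLp)
        ∂(torusMeasure d) := by
  have hint : Integrable (Function.uncurry fun (ω : ℕ → Ω) v =>
      psiOne d ⬝ᵥ fourierTensor r (fun s => C (ω s)) φ₀ n (θ - v) v)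
      ((Measure.infinitePi fun _ : ℕ => μ).prod (torusMeasure d)) := by
    have hmeas : Measurable (Function.uncurry fun (ω : ℕ → Ω) v =>
        psiOne d ⬝ᵥ fourierTensor r (fun s => C (ω s)) φ₀ n (θ - v) v) := by
      simp only [Function.uncurry_def, psiOne_dotProduct]
      exact Finset.measurable_fun_sum _ fun τ _ => measurable_fourierTensor r φ₀
        (fun s _ σ τ => (hCmeas σ τ).comp ((measurable_pi_apply s).comp measurable_fst))
        (measurable_const.sub measurable_snd) measurable_snd (τ, τ)
    refine .of_bound hmeas.aestronglyMeasurable (‖WithLp.toLp 2 (psiOne d)‖ * ‖φ₀‖ ^ 2)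
      (ae_of_all _ fun ⟨ω, v⟩ => ?_)
    rw [← norm_fourierTensor r φ₀ (fun s => hCunit (ω s)) n (θ - v) v]
    exact norm_dotProduct_le _ _
  calc ∑ k ∈ reach r n, planeWave θ k * averagedDist μ C r φ₀ n k
      = ∫ ω : ℕ → Ω, ∑ k ∈ reach r n, planeWave θ k * positionDist r (fun s => C (ω s)) φ₀ n k
          ∂(Measure.infinitePi fun _ : ℕ => μ) := by
        rw [integral_finsetSum _ fun k hk =>
          (integrable_positionDist μ hCmeas hCunit r φ₀ n hk).ofReal.const_mul _]
        simp only [integral_const_mul, averagedDist, integral_complex_ofReal]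
    _ = ∫ ω : ℕ → Ω, ∫ v, psiOne d ⬝ᵥ fourierTensor r (fun s => C (ω s)) φ₀ n (θ - v) v
          ∂(torusMeasure d) ∂(Measure.infinitePi fun _ : ℕ => μ) := by
        simp only [sum_planeWave_mul_positionDist]
    _ = ∫ v, ∫ ω : ℕ → Ω, psiOne d ⬝ᵥ fourierTensor r (fun s => C (ω s)) φ₀ n (θ - v) v
          ∂(Measure.infinitePi fun _ : ℕ => μ) ∂(torusMeasure d) := integral_integral_swap hint
    _ = ∫ v, psiOne d ⬝ᵥ (meanM μ C r (θ - v) v ^ n *ᵥ tensorStar φ₀.ofLp φ₀.ofLp)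
          ∂(torusMeasure d) := by
        refine integral_congr_ae (ae_of_all _ fun v => ?_)
        simp only [psiOne_dotProduct, ← integral_fourierTensor μ hCmeas hCunit r]
        exact integral_finsetSum _ fun τ _ =>
          integrable_fourierTensor μ hCmeas hCunit r φ₀ n (θ - v) v (τ, τ)

lemma sum_averagedDist (n : ℕ) :
    ∑ k ∈ reach r n, averagedDist μ C r φ₀ n k = ‖φ₀‖ ^ 2 := by
  simp only [averagedDist]
  rw [← integral_finsetSum _ fun k hk => integrable_positionDist μ hCmeas hCunit r φ₀ n hk]
  simp only [sum_positionDist r φ₀ fun _ => hCunit _, integral_const, probReal_univ, one_smul]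

end Expectation

section Law

variable {d : ℕ} {Ω : Type*} [MeasurableSpace Ω] (μ : Measure Ω) [IsProbabilityMeasure μ]
  {C : Ω → Matrix (Coin d) (Coin d) ℂ} (r : Coin d → Fin d → ℤ) (φ₀ : CoinSpace d)

lemma averagedDist_nonneg (n : ℕ) (k : Fin d → ℤ) : 0 ≤ averagedDist μ C r φ₀ n k :=
  integral_nonneg fun _ => positionDist_nonneg ..

lemma averagedDist_eq_zero {n : ℕ} {k : Fin d → ℤ} (hk : k ∉ reach r n) :
    averagedDist μ C r φ₀ n k = 0 := by
  simp [averagedDist, positionDist_eq_sum, amplitude_eq_zero r _ φ₀ hk]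

lemma integral_averagedLaw (n : ℕ) (f : (Fin d → ℤ) → ℂ) :
    ∫ k, f k ∂(averagedLaw μ C r φ₀ n) =
      ∑ k ∈ reach r n, (averagedDist μ C r φ₀ n k : ℂ) * f k := by
  rw [averagedLaw, integral_sum_dirac fun _ => ENNReal.ofReal_ne_top, tsum_eq_sum (s := reach r n)]
  · simp [ENNReal.toReal_ofReal (averagedDist_nonneg μ r φ₀ n _)]
  · intro k hk
    simp [averagedDist_eq_zero μ r φ₀ hk]

lemma averagedLaw_univ (n : ℕ) :
    averagedLaw μ C r φ₀ n Set.univ =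
      ENNReal.ofReal (∑ k ∈ reach r n, averagedDist μ C r φ₀ n k) := by
  rw [averagedLaw, Measure.sum_apply _ MeasurableSet.univ, tsum_eq_sum (s := reach r n),
    ENNReal.ofReal_sum_of_nonneg fun k _ => averagedDist_nonneg μ r φ₀ n k]
  · simp
  · intro k hk
    simp [averagedDist_eq_zero μ r φ₀ hk]

lemma isProbabilityMeasure_averagedLaw (hCmeas : ∀ σ τ, Measurable fun ω => C ω σ τ)
    (hCunit : ∀ ω, C ω ∈ Matrix.unitaryGroup (Coin d) ℂ) (hφ₀ : ‖φ₀‖ = 1) (n : ℕ) :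
    IsProbabilityMeasure (averagedLaw μ C r φ₀ n) :=
  ⟨by rw [averagedLaw_univ, sum_averagedDist μ hCmeas hCunit, hφ₀, one_pow, ENNReal.ofReal_one]⟩

end Law

section Stationary

variable {d : ℕ}

lemma star_psiOne : star (psiOne d) = psiOne d := by
  funext t
  simp [psiOne, apply_ite]

lemma psiOne_dotProduct_mulVec_psiOne (A : Matrix (Coin d × Coin d) (Coin d × Coin d) ℂ) :
    psiOne d ⬝ᵥ A *ᵥ psiOne d = ∑ τ, ∑ τ', A (τ, τ) (τ', τ') := by
  simp only [psiOne_dotProduct, Matrix.mulVec, dotProduct_comm _ (psiOne d)]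

lemma projP_mul_mul_projP (A : Matrix (Coin d × Coin d) (Coin d × Coin d) ℂ) :
    projP d * A * projP d = ((2 * (d : ℂ))⁻¹ * ∑ τ, ∑ τ', A (τ, τ) (τ', τ')) • projP d := by
  rw [← psiOne_dotProduct_mulVec_psiOne, Matrix.dotProduct_mulVec]
  simp only [projP, star_psiOne, smul_mul_assoc, mul_smul_comm, Matrix.vecMulVec_mul,
    Matrix.vecMul_vecMulVec, Matrix.vecMulVec_smul, smul_smul]
  congr 1
  ring

lemma psiOne_vecMul_projP (hd : d ≠ 0) : psiOne d ᵥ* projP d = psiOne d := by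
  have hself : psiOne d ⬝ᵥ psiOne d = 2 * (d : ℂ) := by
    rw [psiOne_dotProduct]
    simp [psiOne, mul_comm]
  rw [projP, star_psiOne, Matrix.vecMul_smul, Matrix.vecMul_vecMulVec, hself, smul_smul,
    inv_mul_cancel₀ (by simpa using hd), one_smul]

lemma projP_mulVec_psiOne (hd : d ≠ 0) : projP d *ᵥ psiOne d = psiOne d := by
  have hsymm : (projP d)ᵀ = projP d := by
    rw [projP, star_psiOne, Matrix.transpose_smul, Matrix.transpose_vecMulVec]
  rw [← hsymm, Matrix.mulVec_transpose, psiOne_vecMul_projP hd]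

lemma projP_ne_zero (hd : d ≠ 0) : projP d ≠ 0 := by
  intro h
  have hψ := psiOne_vecMul_projP hd
  rw [h, Matrix.vecMul_zero] at hψ
  have τ : Coin d := (⟨0, Nat.pos_of_ne_zero hd⟩, 1)
  simpa [psiOne] using congrFun hψ (τ, τ)

lemma projP_mul {M : Matrix (Coin d × Coin d) (Coin d × Coin d) ℂ}
    (hM : psiOne d ᵥ* M = psiOne d) : projP d * M = projP d := by
  rw [projP, star_psiOne, smul_mul_assoc, Matrix.vecMulVec_mul, hM]

lemma mul_projP {M : Matrix (Coin d × Coin d) (Coin d × Coin d) ℂ}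
    (hM : M *ᵥ psiOne d = psiOne d) : M * projP d = projP d := by
  rw [projP, star_psiOne, mul_smul_comm, Matrix.mul_vecMulVec, hM]

lemma kronecker_map_star_mulVec_psiOne {A : Matrix (Coin d) (Coin d) ℂ}
    (hA : A ∈ Matrix.unitaryGroup (Coin d) ℂ) : (A ⊗ₖ A.map star) *ᵥ psiOne d = psiOne d := by
  funext t
  have h := congrFun (congrFun (Matrix.mem_unitaryGroup_iff.1 hA) t.1) t.2
  rw [Matrix.mul_apply, Matrix.one_apply] at h
  rw [Matrix.mulVec, dotProduct_comm, psiOne_dotProduct]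
  exact h

lemma psiOne_vecMul_kronecker_map_star {A : Matrix (Coin d) (Coin d) ℂ}
    (hA : A ∈ Matrix.unitaryGroup (Coin d) ℂ) : psiOne d ᵥ* (A ⊗ₖ A.map star) = psiOne d := by
  rw [← Matrix.mulVec_transpose, ← Matrix.kroneckerMap_transpose, ← Matrix.transpose_map]
  exact kronecker_map_star_mulVec_psiOne (Matrix.transpose_mem_unitaryGroup_iff.2 hA)

variable {Ω : Type*} [MeasurableSpace Ω] (μ : Measure Ω) [IsProbabilityMeasure μ]
  {C : Ω → Matrix (Coin d) (Coin d) ℂ} (hCmeas : ∀ σ τ, Measurable fun ω => C ω σ τ)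
  (hCunit : ∀ ω, C ω ∈ Matrix.unitaryGroup (Coin d) ℂ) (r : Coin d → Fin d → ℤ)

include hCmeas hCunit

lemma meanTensor_mulVec_psiOne : meanTensor μ C *ᵥ psiOne d = psiOne d := by
  have hψ (ω : Ω) (t : Coin d × Coin d) : ∑ τ, (C ω ⊗ₖ (C ω).map star) t (τ, τ) = psiOne d t := by
    rw [← psiOne_dotProduct ((C ω ⊗ₖ (C ω).map star) t), dotProduct_comm]
    exact congrFun (kronecker_map_star_mulVec_psiOne (hCunit ω)) t
  funext t
  rw [Matrix.mulVec, dotProduct_comm, psiOne_dotProduct]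
  simp only [meanTensor, Matrix.of_apply]
  rw [← integral_finsetSum _ fun τ _ => integrable_kronecker_map_star μ hCmeas hCunit t (τ, τ)]
  simp only [hψ, integral_const, probReal_univ, one_smul]

lemma psiOne_vecMul_meanTensor : psiOne d ᵥ* meanTensor μ C = psiOne d := by
  have hψ (ω : Ω) (t : Coin d × Coin d) : ∑ τ, (C ω ⊗ₖ (C ω).map star) (τ, τ) t = psiOne d t := by
    rw [← psiOne_dotProduct fun s => (C ω ⊗ₖ (C ω).map star) s t]
    exact congrFun (psiOne_vecMul_kronecker_map_star (hCunit ω)) t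
  funext t
  rw [Matrix.vecMul, psiOne_dotProduct]
  simp only [meanTensor, Matrix.of_apply]
  rw [← integral_finsetSum _ fun τ _ => integrable_kronecker_map_star μ hCmeas hCunit (τ, τ) t]
  simp only [hψ, integral_const, probReal_univ, one_smul]

lemma projP_mul_meanM (v : Fin d → ℝ) : projP d * meanM μ C r (-v) v = projP d := by
  refine projP_mul ?_
  rw [meanM, ← Matrix.vecMul_vecMul, phaseMatrix_eq,
    psiOne_vecMul_kronecker_map_star (diagonal_planeWave_mem_unitaryGroup r (-v)),
    psiOne_vecMul_meanTensor μ hCmeas hCunit]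

lemma meanM_mul_projP (v : Fin d → ℝ) : meanM μ C r (-v) v * projP d = projP d := by
  refine mul_projP ?_
  rw [meanM, ← Matrix.mulVec_mulVec, meanTensor_mulVec_psiOne μ hCmeas hCunit, phaseMatrix_eq,
    kronecker_map_star_mulVec_psiOne (diagonal_planeWave_mem_unitaryGroup r (-v))]

open scoped Matrix.Norms.L2Operator in
lemma isReducedResolvent_reducedResolvent (hd : d ≠ 0) {v : Fin d → ℝ}
    (hsimple : (meanM μ C r (-v) v).charpoly.rootMultiplicity 1 = 1) :
    IsReducedResolvent (meanM μ C r (-v) v) (projP d) (reducedResolvent μ C r v) := by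
  have hPM := projP_mul_meanM μ hCmeas hCunit r v
  have hMP := meanM_mul_projP μ hCmeas hCunit r v
  have hP := mul_projP (projP_mulVec_psiOne hd)
  have hunit : IsUnit (meanM μ C r (-v) v - projP d - 1) := by
    refine isUnit_sub_sub_one_of_finrank_eigenspace_le_one hPM hMP hP (projP_ne_zero hd) ?_
    rw [← hsimple, ← Matrix.charpoly_toLin']
    exact LinearMap.finrank_eigenspace_le (Matrix.toLin' (meanM μ C r (-v) v)) 1
  have hlim := (tendsto_inverse_sub_smul_proj hPM hMP hP hunit).limUnder_eq
  simp only [← Matrix.nonsing_inv_eq_ringInverse] at hlim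
  have hres := isReducedResolvent_inverse_mul hPM hMP hP hunit
  rw [← Matrix.nonsing_inv_eq_ringInverse, ← hlim] at hres
  exact hres

end Stationary

section Diffusion

variable {d : ℕ} (r : Coin d → Fin d → ℤ)

/-- The jump `r(τ) - r̄` relative to the drift. -/
def centredJump (τ : Coin d) (j : Fin d) : ℝ := r τ j - drift r j

/-- The matrix `X` with `exp (ε X) = e^{-iεy·r̄} D(εy, 0)`, the perturbation of `ℳ(-v, v)` in the
direction `y`. -/
def jumpGenerator (y : Fin d → ℝ) : Matrix (Coin d × Coin d) (Coin d × Coin d) ℂ :=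
  Complex.I • Matrix.diagonal fun t => ((y ⬝ᵥ centredJump r t.1 : ℝ) : ℂ)

lemma sum_centredJump (hd : d ≠ 0) (j : Fin d) : ∑ τ, centredJump r τ j = 0 := by
  have hd' : (d : ℝ) ≠ 0 := by exact_mod_cast hd
  simp only [centredJump, drift, mul_inv_rev, Finset.sum_sub_distrib, Finset.sum_const,
    Finset.card_univ, Fintype.card_prod, Fintype.card_fin, Fintype.card_units_int, nsmul_eq_mul,
    Nat.cast_mul, Nat.cast_ofNat]
  field_simp
  ring

lemma sum_centredJump_mul_centredJump (hd : d ≠ 0) (i j : Fin d) :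
    ∑ τ, centredJump r τ i * centredJump r τ j =
      ∑ τ, (r τ i : ℝ) * r τ j - 2 * d * (drift r i * drift r j) := by
  have hexpand (τ : Coin d) : (r τ i : ℝ) * r τ j = centredJump r τ i * centredJump r τ j +
      (drift r i * centredJump r τ j + centredJump r τ i * drift r j) + drift r i * drift r j := by
    simp only [centredJump]
    ring
  simp only [hexpand, Finset.sum_add_distrib, ← Finset.mul_sum, ← Finset.sum_mul,
    sum_centredJump r hd, mul_zero, zero_mul, add_zero, Finset.sum_const, Finset.card_univ,
    Fintype.card_prod, Fintype.card_fin, Fintype.card_units_int, nsmul_eq_mul, Nat.cast_mul,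
    Nat.cast_ofNat]
  ring

lemma sum_eq_zero_of_projP_mul_eq_zero (hd : d ≠ 0)
    {S : Matrix (Coin d × Coin d) (Coin d × Coin d) ℂ} (hS : projP d * S = 0)
    (t : Coin d × Coin d) : ∑ τ, S (τ, τ) t = 0 := by
  have hψ : psiOne d ᵥ* S = 0 := by
    rw [← psiOne_vecMul_projP hd, Matrix.vecMul_vecMul, hS, Matrix.vecMul_zero]
  rw [← psiOne_dotProduct fun s => S s t]
  exact congrFun hψ t

lemma sum_eq_zero_of_mul_projP_eq_zero (hd : d ≠ 0)
    {S : Matrix (Coin d × Coin d) (Coin d × Coin d) ℂ} (hS : S * projP d = 0)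
    (t : Coin d × Coin d) : ∑ τ, S t (τ, τ) = 0 := by
  have hψ : S *ᵥ psiOne d = 0 := by
    rw [← projP_mulVec_psiOne hd, Matrix.mulVec_mulVec, hS, Matrix.zero_mulVec]
  rw [← psiOne_dotProduct, dotProduct_comm]
  exact congrFun hψ t

lemma sum_sub_mul_sub_mul {ι R : Type*} [Fintype ι] [CommRing R] (S : ι → ι → R)
    (hrow : ∀ i, ∑ j, S i j = 0) (hcol : ∀ j, ∑ i, S i j = 0) (f g : ι → R) (a b : R) :
    ∑ i, ∑ j, (f i - a) * (g j - b) * S i j = ∑ i, ∑ j, f i * g j * S i j := by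
  have hf : ∑ i, ∑ j, (f i - a) * b * S i j = 0 := by
    simp only [← Finset.mul_sum, hrow, mul_zero, Finset.sum_const_zero]
  have hg : ∑ i, ∑ j, a * g j * S i j = 0 := by
    rw [Finset.sum_comm]
    simp only [← Finset.mul_sum, hcol, mul_zero, Finset.sum_const_zero]
  have hexpand (i j : ι) : (f i - a) * (g j - b) * S i j =
      f i * g j * S i j - a * g j * S i j - (f i - a) * b * S i j := by
    ring
  simp only [hexpand, Finset.sum_sub_distrib, hf, hg, sub_zero]

variable {Ω : Type*} [MeasurableSpace Ω] (μ : Measure Ω) {C : Ω → Matrix (Coin d) (Coin d) ℂ}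

lemma diffusionMatrix_apply_comm (v : Fin d → ℝ) (i j : Fin d) :
    diffusionMatrix μ C r v i j = diffusionMatrix μ C r v j i := by
  simp only [diffusionMatrix, Matrix.of_apply, mul_comm, add_comm]

lemma diffusionMatrix_eq (hd : d ≠ 0) (v : Fin d → ℝ)
    (hPS : projP d * reducedResolvent μ C r v = 0) (hSP : reducedResolvent μ C r v * projP d = 0) :
    diffusionMatrix μ C r v = -(2 * (d : ℂ))⁻¹ • (∑ τ, Matrix.vecMulVec
        (Complex.ofReal ∘ centredJump r τ) (Complex.ofReal ∘ centredJump r τ) +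
      ∑ τ, ∑ τ', reducedResolvent μ C r v (τ, τ) (τ', τ') •
        (Matrix.vecMulVec (Complex.ofReal ∘ centredJump r τ) (Complex.ofReal ∘ centredJump r τ') +
          Matrix.vecMulVec (Complex.ofReal ∘ centredJump r τ')
            (Complex.ofReal ∘ centredJump r τ))) := by
  have hd' : (d : ℂ) ≠ 0 := by exact_mod_cast hd
  ext i j
  have hcov := congrArg Complex.ofReal (sum_centredJump_mul_centredJump r hd i j)
  have hres (i j : Fin d) := sum_sub_mul_sub_mul
    (fun τ τ' => reducedResolvent μ C r v (τ, τ) (τ', τ'))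
    (fun τ => sum_eq_zero_of_mul_projP_eq_zero hd hSP (τ, τ))
    (fun τ => sum_eq_zero_of_projP_mul_eq_zero hd hPS (τ, τ))
    (fun τ => (r τ i : ℂ)) (fun τ => (r τ j : ℂ)) (drift r i) (drift r j)
  have hsum : ∑ τ, ∑ τ', reducedResolvent μ C r v (τ, τ) (τ', τ') *
      ((centredJump r τ i : ℂ) * centredJump r τ' j + centredJump r τ' i * centredJump r τ j) =
      ∑ τ, ∑ τ', ((r τ i : ℂ) * r τ' j + r τ j * r τ' i) *
        reducedResolvent μ C r v (τ, τ) (τ', τ') := by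
    simp only [add_mul, Finset.sum_add_distrib, ← hres]
    simp only [← Finset.sum_add_distrib, centredJump, Complex.ofReal_sub, Complex.ofReal_intCast]
    exact Finset.sum_congr rfl fun τ _ => Finset.sum_congr rfl fun τ' _ => by ring
  push_cast at hcov
  simp only [diffusionMatrix, Matrix.of_apply, Matrix.smul_apply, Matrix.add_apply,
    Matrix.sum_apply, Matrix.vecMulVec_apply, Function.comp_apply, smul_eq_mul, hsum, hcov]
  push_cast
  field_simp
  ring

lemma dotProduct_diffusionMatrix_mulVec (hd : d ≠ 0) (v y : Fin d → ℝ)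
    (hPS : projP d * reducedResolvent μ C r v = 0) (hSP : reducedResolvent μ C r v * projP d = 0) :
    (Complex.ofReal ∘ y) ⬝ᵥ diffusionMatrix μ C r v *ᵥ (Complex.ofReal ∘ y) =
      -(2 * (d : ℂ))⁻¹ * (∑ τ, ((y ⬝ᵥ centredJump r τ : ℝ) : ℂ) ^ 2 +
        2 * ∑ τ, ∑ τ', ((y ⬝ᵥ centredJump r τ : ℝ) : ℂ) * (y ⬝ᵥ centredJump r τ' : ℝ) *
          reducedResolvent μ C r v (τ, τ) (τ', τ')) := by
  have hvec (τ τ' : Coin d) : (Complex.ofReal ∘ y) ⬝ᵥ Matrix.vecMulVec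
      (Complex.ofReal ∘ centredJump r τ) (Complex.ofReal ∘ centredJump r τ') *ᵥ
        (Complex.ofReal ∘ y) = (y ⬝ᵥ centredJump r τ : ℝ) * (y ⬝ᵥ centredJump r τ' : ℝ) := by
    have hcast (τ : Coin d) := RingHom.map_dotProduct Complex.ofRealHom y (centredJump r τ)
    rw [Matrix.vecMulVec_mulVec, dotProduct_smul, op_smul_eq_mul,
      dotProduct_comm (Complex.ofReal ∘ centredJump r τ')]
    exact congrArg₂ (· * ·) (hcast τ).symm (hcast τ').symm
  rw [diffusionMatrix_eq r μ hd v hPS hSP]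
  simp only [Matrix.smul_mulVec, Matrix.add_mulVec, Matrix.sum_mulVec, dotProduct_smul,
    dotProduct_add, dotProduct_sum, hvec, smul_eq_mul, sq]
  congr 2
  simp only [Finset.mul_sum]
  exact Finset.sum_congr rfl fun τ _ => Finset.sum_congr rfl fun τ' _ => by ring

lemma exp_jumpGenerator_mul_meanM (v y : Fin d → ℝ) (ε : ℝ) :
    NormedSpace.exp ((ε : ℂ) • jumpGenerator r y) * meanM μ C r (-v) v =
      Complex.exp (-(Complex.I * (ε * (y ⬝ᵥ (drift r).ofLp) : ℝ))) •
        meanM μ C r (ε • y - v) v := by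
  rw [jumpGenerator, exp_smul_I_diagonal, meanM, meanM, ← mul_assoc, ← smul_mul_assoc]
  congr 1
  rw [phaseMatrix, phaseMatrix, Matrix.diagonal_mul_diagonal, ← Matrix.diagonal_smul]
  congr 1
  funext t
  rw [Pi.smul_apply, smul_eq_mul, ← Complex.exp_add, ← Complex.exp_add]
  congr 1
  have hcentred : y ⬝ᵥ centredJump r t.1 = ∑ j, y j * (r t.1 j : ℝ) - y ⬝ᵥ (drift r).ofLp := by
    simp only [dotProduct, centredJump, mul_sub, Finset.sum_sub_distrib]
  simp only [hcentred, Pi.neg_apply, Pi.sub_apply, Pi.smul_apply, smul_eq_mul, sub_mul, neg_mul,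
    mul_assoc, Finset.sum_sub_distrib, Finset.sum_neg_distrib, ← Finset.mul_sum]
  push_cast
  ring

lemma projP_mul_jumpGenerator_mul_projP (hd : d ≠ 0) (y : Fin d → ℝ) :
    projP d * jumpGenerator r y * projP d = 0 := by
  have hsum : ∑ τ, y ⬝ᵥ centredJump r τ = 0 := by
    rw [← dotProduct_sum, show ∑ τ, centredJump r τ = 0 from funext fun j => by
      rw [Finset.sum_apply, sum_centredJump r hd, Pi.zero_apply], dotProduct_zero]
  rw [projP_mul_mul_projP]
  simp [jumpGenerator, Matrix.diagonal_apply, ← Finset.mul_sum, ← Complex.ofReal_sum, hsum]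

lemma jumpGenerator_mul_mul_jumpGenerator_apply (y : Fin d → ℝ)
    (S : Matrix (Coin d × Coin d) (Coin d × Coin d) ℂ) (s t : Coin d × Coin d) :
    (jumpGenerator r y * S * jumpGenerator r y) s t =
      -((y ⬝ᵥ centredJump r s.1 : ℝ) * (y ⬝ᵥ centredJump r t.1 : ℝ) * S s t) := by
  rw [jumpGenerator, mul_smul_comm, smul_mul_assoc, smul_mul_assoc, smul_smul, Complex.I_mul_I,
    Matrix.smul_apply, Matrix.mul_diagonal, Matrix.diagonal_mul, neg_one_smul]
  ring

lemma projP_mul_secondOrder_jumpGenerator_mul_projP (hd : d ≠ 0) (v y : Fin d → ℝ)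
    (hPS : projP d * reducedResolvent μ C r v = 0) (hSP : reducedResolvent μ C r v * projP d = 0) :
    projP d * jumpGenerator r y ^ 2 * projP d + (2 : ℂ) •
      (projP d * jumpGenerator r y * reducedResolvent μ C r v * jumpGenerator r y * projP d) =
        ((Complex.ofReal ∘ y) ⬝ᵥ diffusionMatrix μ C r v *ᵥ (Complex.ofReal ∘ y)) • projP d := by
  have hsq : ∑ τ : Coin d, ∑ τ', (jumpGenerator r y ^ 2) (τ, τ) (τ', τ') =
      -∑ τ, ((y ⬝ᵥ centredJump r τ : ℝ) : ℂ) ^ 2 := by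
    have hsq_eq : jumpGenerator r y ^ 2 = jumpGenerator r y * 1 * jumpGenerator r y := by
      rw [mul_one, sq]
    simp only [hsq_eq, jumpGenerator_mul_mul_jumpGenerator_apply]
    simp [Matrix.one_apply, sq]
  have hres : ∑ τ : Coin d, ∑ τ', (jumpGenerator r y * reducedResolvent μ C r v *
      jumpGenerator r y) (τ, τ) (τ', τ') = -∑ τ, ∑ τ', ((y ⬝ᵥ centredJump r τ : ℝ) : ℂ) *
        (y ⬝ᵥ centredJump r τ' : ℝ) * reducedResolvent μ C r v (τ, τ) (τ', τ') := by
    simp only [jumpGenerator_mul_mul_jumpGenerator_apply, Finset.sum_neg_distrib]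
  have hassoc : projP d * jumpGenerator r y * reducedResolvent μ C r v * jumpGenerator r y *
      projP d = projP d * (jumpGenerator r y * reducedResolvent μ C r v * jumpGenerator r y) *
        projP d := by
    simp only [mul_assoc]
  rw [dotProduct_diffusionMatrix_mulVec r μ hd v y hPS hSP, hassoc, projP_mul_mul_projP,
    projP_mul_mul_projP, hsq, hres, smul_smul, ← add_smul]
  congr 1
  ring

end Diffusion

section Limit

lemma ne_zero_of_norm_eq_one {d : ℕ} {φ : CoinSpace d} (hφ : ‖φ‖ = 1) : d ≠ 0 := by
  rintro rfl
  simp [EuclideanSpace.norm_eq] at hφ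

variable {d : ℕ} {Ω : Type*} [MeasurableSpace Ω] (μ : Measure Ω) [IsProbabilityMeasure μ]
  {C : Ω → Matrix (Coin d) (Coin d) ℂ} (hCmeas : ∀ σ τ, Measurable fun ω => C ω σ τ)
  (hCunit : ∀ ω, C ω ∈ Matrix.unitaryGroup (Coin d) ℂ) (r : Coin d → Fin d → ℤ)

omit [IsProbabilityMeasure μ] in
lemma continuous_meanM : Continuous fun v : Fin d → ℝ => meanM μ C r (-v) v := by
  simp only [meanM, phaseMatrix]
  fun_prop

lemma exp_inner_rescale (n : ℕ) (k : Fin d → ℤ) (y : EuclideanSpace ℝ (Fin d)) :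
    Complex.exp ((inner ℝ (rescale r n k) y : ℝ) * Complex.I) =
      Complex.exp (-(Complex.I * ((√(n : ℝ))⁻¹ * (y.ofLp ⬝ᵥ (drift r).ofLp) : ℝ))) ^ n *
        planeWave ((√(n : ℝ))⁻¹ • y.ofLp) k := by
  have hinner : inner ℝ (rescale r n k) y = (√(n : ℝ))⁻¹ * (∑ j, y j * (k j : ℝ)) -
      n * ((√(n : ℝ))⁻¹ * (y.ofLp ⬝ᵥ (drift r).ofLp)) := by
    simp only [rescale, dotProduct, PiLp.inner_apply, Finset.mul_sum, ← Finset.sum_sub_distrib]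
    refine Finset.sum_congr rfl fun j _ => ?_
    simp only [PiLp.smul_apply, PiLp.sub_apply, smul_eq_mul, RCLike.inner_apply, Real.ringHom_apply]
    ring
  rw [planeWave, ← Complex.exp_nat_mul, ← Complex.exp_add, hinner]
  congr 1
  simp only [Pi.smul_apply, smul_eq_mul, mul_assoc, ← Finset.mul_sum]
  push_cast
  ring

include hCmeas hCunit

open scoped Matrix.Norms.L2Operator in
lemma norm_meanM_le_one (y y' : Fin d → ℝ) : ‖meanM μ C r y y'‖ ≤ 1 := by
  have hphase : ‖phaseMatrix r y y'‖ ≤ 1 := by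
    rw [phaseMatrix_eq]
    exact norm_le_one_of_mem_unitaryGroup (Matrix.kronecker_mem_unitary
      (diagonal_planeWave_mem_unitaryGroup r y)
      (Matrix.map_star_mem_unitaryGroup_iff.2 (diagonal_planeWave_mem_unitaryGroup r (-y'))))
  exact (norm_mul_le_of_le hphase (norm_meanTensor_le_one μ hCmeas hCunit)).trans_eq (mul_one _)

open scoped Matrix.Norms.L2Operator in
lemma norm_exp_jumpGenerator_mul_meanM_le_one (v y : Fin d → ℝ) (ε : ℝ) :
    ‖NormedSpace.exp ((ε : ℂ) • jumpGenerator r y) * meanM μ C r (-v) v‖ ≤ 1 := by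
  rw [exp_jumpGenerator_mul_meanM, norm_smul, ← mul_neg, ← Complex.ofReal_neg, mul_comm Complex.I,
    Complex.norm_exp_ofReal_mul_I, one_mul]
  exact norm_meanM_le_one μ hCmeas hCunit r _ _

open scoped Matrix.Norms.L2Operator in
lemma tendsto_projP_mul_pow (hd : d ≠ 0) {v : Fin d → ℝ}
    (hsimple : (meanM μ C r (-v) v).charpoly.rootMultiplicity 1 = 1) (y : Fin d → ℝ) :
    Tendsto (fun n : ℕ => projP d * (NormedSpace.exp ((((√(n : ℝ))⁻¹ : ℝ) : ℂ) •
      jumpGenerator r y) * meanM μ C r (-v) v) ^ n) atTop (𝓝 (Complex.exp (-((Complex.ofReal ∘ y) ⬝ᵥ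
        diffusionMatrix μ C r v *ᵥ (Complex.ofReal ∘ y) / 2)) • projP d)) := by
  have hres := isReducedResolvent_reducedResolvent μ hCmeas hCunit r hd hsimple
  exact hres.tendsto_mul_exp_smul_mul_pow (projP_mul_meanM μ hCmeas hCunit r v)
    (meanM_mul_projP μ hCmeas hCunit r v) (mul_projP (projP_mulVec_psiOne hd))
    (norm_exp_jumpGenerator_mul_meanM_le_one μ hCmeas hCunit r v y)
    (projP_mul_jumpGenerator_mul_projP r hd y)
    (projP_mul_secondOrder_jumpGenerator_mul_projP r μ hd v y hres.proj_mul hres.mul_proj)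

lemma re_dotProduct_diffusionMatrix_mulVec_nonneg (hd : d ≠ 0) {v : Fin d → ℝ}
    (hsimple : (meanM μ C r (-v) v).charpoly.rootMultiplicity 1 = 1) (y : Fin d → ℝ) :
    0 ≤ ((Complex.ofReal ∘ y) ⬝ᵥ diffusionMatrix μ C r v *ᵥ (Complex.ofReal ∘ y)).re := by
  open scoped Matrix.Norms.L2Operator in
  exact re_nonneg_of_tendsto_mul_pow (projP_ne_zero hd)
    (fun n : ℕ => norm_exp_jumpGenerator_mul_meanM_le_one μ hCmeas hCunit r v y (√(n : ℝ))⁻¹)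
    (tendsto_projP_mul_pow μ hCmeas hCunit r hd hsimple y)

lemma posSemidef_of_diffusionMatrix_eq (hd : d ≠ 0) {v : Fin d → ℝ}
    (hsimple : (meanM μ C r (-v) v).charpoly.rootMultiplicity 1 = 1)
    {D : Matrix (Fin d) (Fin d) ℝ} (hD : diffusionMatrix μ C r v = D.map Complex.ofReal) :
    D.PosSemidef := by
  refine .of_dotProduct_mulVec_nonneg ?_ fun y => ?_
  · ext i j
    have hsymm := diffusionMatrix_apply_comm r μ (C := C) v j i
    simpa [hD] using hsymm
  · have hre := re_dotProduct_diffusionMatrix_mulVec_nonneg μ hCmeas hCunit r hd hsimple y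
    rw [hD, ofReal_dotProduct_map_mulVec, Complex.ofReal_re] at hre
    simpa only [star_trivial] using hre

lemma tendsto_psiOne_dotProduct_pow_mulVec (hd : d ≠ 0) {v : Fin d → ℝ}
    (hsimple : (meanM μ C r (-v) v).charpoly.rootMultiplicity 1 = 1) (y : Fin d → ℝ)
    (w : Coin d × Coin d → ℂ) :
    Tendsto (fun n : ℕ => psiOne d ⬝ᵥ (NormedSpace.exp ((((√(n : ℝ))⁻¹ : ℝ) : ℂ) •
      jumpGenerator r y) * meanM μ C r (-v) v) ^ n *ᵥ w) atTop
        (𝓝 (Complex.exp (-((Complex.ofReal ∘ y) ⬝ᵥ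
          diffusionMatrix μ C r v *ᵥ (Complex.ofReal ∘ y) / 2)) * (psiOne d ⬝ᵥ w))) := by
  have hproj (x : Coin d × Coin d → ℂ) : psiOne d ⬝ᵥ projP d *ᵥ x = psiOne d ⬝ᵥ x := by
    rw [Matrix.dotProduct_mulVec, psiOne_vecMul_projP hd]
  have hcont : Continuous fun A : Matrix (Coin d × Coin d) (Coin d × Coin d) ℂ =>
      psiOne d ⬝ᵥ A *ᵥ w := by fun_prop
  have hlim := (hcont.tendsto _).comp (tendsto_projP_mul_pow μ hCmeas hCunit r hd hsimple y)
  simp only [Function.comp_def, ← Matrix.mulVec_mulVec, Matrix.smul_mulVec, dotProduct_smul,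
    smul_eq_mul, hproj] at hlim
  exact hlim

variable (φ₀ : CoinSpace d)

lemma charFun_averagedLaw (n : ℕ) (y : EuclideanSpace ℝ (Fin d)) :
    charFun ((averagedLaw μ C r φ₀ n).map (rescale r n)) y =
      ∫ v, psiOne d ⬝ᵥ (NormedSpace.exp ((((√(n : ℝ))⁻¹ : ℝ) : ℂ) • jumpGenerator r y) *
        meanM μ C r (-v) v) ^ n *ᵥ tensorStar φ₀.ofLp φ₀.ofLp ∂(torusMeasure d) := by
  rw [charFun_apply, integral_map Measurable.of_discrete.aemeasurable (by fun_prop),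
    integral_averagedLaw]
  simp only [exp_inner_rescale, exp_jumpGenerator_mul_meanM, smul_pow, Matrix.smul_mulVec,
    dotProduct_smul, smul_eq_mul]
  rw [integral_const_mul, ← sum_planeWave_mul_averagedDist μ hCmeas hCunit, Finset.mul_sum]
  exact Finset.sum_congr rfl fun k _ => by ring

open scoped Matrix.Norms.L2Operator in
lemma tendsto_charFun_averagedLaw (hφ₀ : ‖φ₀‖ = 1)
    (hsimple : ∀ᵐ v ∂(torusMeasure d), (meanM μ C r (-v) v).charpoly.rootMultiplicity 1 = 1)
    (y : EuclideanSpace ℝ (Fin d)) :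
    Tendsto (fun n => charFun ((averagedLaw μ C r φ₀ n).map (rescale r n)) y) atTop
      (𝓝 (∫ v, Complex.exp (-((Complex.ofReal ∘ y.ofLp) ⬝ᵥ
        diffusionMatrix μ C r v *ᵥ (Complex.ofReal ∘ y.ofLp) / 2)) ∂(torusMeasure d))) := by
  have hd : d ≠ 0 := ne_zero_of_norm_eq_one hφ₀
  have hψφ : psiOne d ⬝ᵥ tensorStar φ₀.ofLp φ₀.ofLp = 1 := by
    rw [psiOne_dotProduct_tensorStar, dotProduct_star_self, WithLp.toLp_ofLp, hφ₀,
      Complex.ofReal_one, one_pow]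
  simp only [charFun_averagedLaw μ hCmeas hCunit]
  refine tendsto_integral_of_dominated_convergence
    (fun _ => ‖WithLp.toLp 2 (psiOne d)‖ * (‖(1 : Matrix (Coin d × Coin d) (Coin d × Coin d) ℂ)‖ *
      ‖WithLp.toLp 2 (tensorStar φ₀.ofLp φ₀.ofLp)‖)) (fun n => ?_) (integrable_const _)
    (fun n => ae_of_all _ fun v => (norm_dotProduct_mulVec_le _ _ _).trans ?_) ?_
  · have hcont := continuous_meanM μ (C := C) r
    exact Continuous.aestronglyMeasurable (by fun_prop)
  · have hpow := norm_mul_pow_le 1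
      (norm_exp_jumpGenerator_mul_meanM_le_one μ hCmeas hCunit r v y (√(n : ℝ))⁻¹) n
    rw [one_mul] at hpow
    gcongr
  · filter_upwards [hsimple] with v hv
    have hlim := tendsto_psiOne_dotProduct_pow_mulVec μ hCmeas hCunit r hd hv y
      (tensorStar φ₀.ofLp φ₀.ofLp)
    rwa [hψφ, mul_one] at hlim

end Limit

end QuantumWalk

end

theorem mainTheorem3_general {d : ℕ} {Ω : Type*} [MeasurableSpace Ω]
    (μ : Measure Ω) [IsProbabilityMeasure μ]
    (C : Ω → Matrix (QuantumWalk.Coin d) (QuantumWalk.Coin d) ℂ)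
    (hCmeas : ∀ σ τ, Measurable fun ω => C ω σ τ)
    (hCunit : ∀ ω, C ω ∈ Matrix.unitaryGroup (QuantumWalk.Coin d) ℂ)
    (r : QuantumWalk.Coin d → Fin d → ℤ)
    (hsimple : ∀ᵐ v ∂(QuantumWalk.torusMeasure d),
      (QuantumWalk.meanM μ C r (-v) v).charpoly.rootMultiplicity 1 = 1)
    (D : Matrix (Fin d) (Fin d) ℝ)
    (hDv : ∀ᵐ v ∂(QuantumWalk.torusMeasure d),
      QuantumWalk.diffusionMatrix μ C r v = D.map Complex.ofReal)
    (φ₀ : QuantumWalk.CoinSpace d) (hφ₀ : ‖φ₀‖ = 1) :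
    ∃ _ : ∀ n, IsProbabilityMeasure (QuantumWalk.averagedLaw μ C r φ₀ n),
      TendstoInDistribution (fun n : ℕ => QuantumWalk.rescale r n) atTop
        (id : EuclideanSpace ℝ (Fin d) → EuclideanSpace ℝ (Fin d))
        (fun n => QuantumWalk.averagedLaw μ C r φ₀ n) (multivariateGaussian 0 D) := by
  obtain ⟨v, hv_simple, hv_eq⟩ := (hsimple.and hDv).exists
  have hD : D.PosSemidef := QuantumWalk.posSemidef_of_diffusionMatrix_eq μ hCmeas hCunit r
    (QuantumWalk.ne_zero_of_norm_eq_one hφ₀) hv_simple hv_eq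
  have hprob := QuantumWalk.isProbabilityMeasure_averagedLaw μ r φ₀ hCmeas hCunit hφ₀
  refine ⟨hprob, ⟨fun n => Measurable.of_discrete.aemeasurable, aemeasurable_id, ?_⟩⟩
  refine ProbabilityMeasure.tendsto_iff_tendsto_charFun.2 fun y => ?_
  have hgauss : ∫ v, Complex.exp (-((Complex.ofReal ∘ y.ofLp) ⬝ᵥ
      QuantumWalk.diffusionMatrix μ C r v *ᵥ (Complex.ofReal ∘ y.ofLp) / 2))
        ∂(QuantumWalk.torusMeasure d) = charFun (multivariateGaussian 0 D) y := by
    rw [integral_congr_ae (g := fun _ => Complex.exp (-((y.ofLp ⬝ᵥ D *ᵥ y.ofLp : ℝ) / 2)))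
      (hDv.mono fun v hv => by simp only [hv, QuantumWalk.ofReal_dotProduct_map_mulVec]),
      charFun_multivariateGaussian hD, integral_const, probReal_univ, one_smul, inner_zero_right]
    simp
  simpa [hgauss] using
    QuantumWalk.tendsto_charFun_averagedLaw μ hCmeas hCunit r φ₀ hφ₀ hsimple y

theorem mainTheorem3 {d : ℕ} {Ω : Type*} [MeasurableSpace Ω]
    (μ : Measure Ω) [IsProbabilityMeasure μ]
    (C : Ω → Matrix (QuantumWalk.Coin d) (QuantumWalk.Coin d) ℂ)
    (hCmeas : ∀ σ τ, Measurable fun ω => C ω σ τ)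
    (hCunit : ∀ ω, C ω ∈ Matrix.unitaryGroup (QuantumWalk.Coin d) ℂ)
    (r : QuantumWalk.Coin d → Fin d → ℤ)
    (hS : QuantumWalk.AssumptionS μ C r)
    (D : Matrix (Fin d) (Fin d) ℝ) (hD : D.PosDef)
    (hDv : ∀ v : Fin d → ℝ, QuantumWalk.diffusionMatrix μ C r v = D.map Complex.ofReal)
    (φ₀ : QuantumWalk.CoinSpace d) (hφ₀ : ‖φ₀‖ = 1) :
    ∃ _ : ∀ n, IsProbabilityMeasure (QuantumWalk.averagedLaw μ C r φ₀ n),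
      TendstoInDistribution (fun n : ℕ => QuantumWalk.rescale r n) atTop
        (id : EuclideanSpace ℝ (Fin d) → EuclideanSpace ℝ (Fin d))
        (fun n => QuantumWalk.averagedLaw μ C r φ₀ n) (multivariateGaussian 0 D) :=
  mainTheorem3_general μ C hCmeas hCunit r (ae_of_all _ fun v => (hS v).2) D (ae_of_all _ hDv)
    φ₀ hφ₀
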